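/- Let $\Gamma$ be a finite simplicial graph with vertex set $V$, edge set $E$ and an edge-labelling $m\colon E\to\{2,3,4,\dots\}$, and let $$A_\Gamma=\langle V \mid \underbrace{vwv\cdots}_{m(\{v,w\})\text{ letters}}=\underbrace{wvw\cdots}_{m(\{v,w\})\text{ letters}}\ \text{ for all } \{v,w\}\in E\rangle$$ be the associated Artin group. For $X\subseteq V$ let $A_X$ denote the subgroup of $A_\Gamma$ generated by $X$. A parabolic subgroup of $A_\Gamma$ is a subgroup of the form $gA_Xg^{-1}$ with $X\subseteq V$ and $g\in A_\Gamma$; for $Y\subseteq V$, a parabolic subgroup of $A_Y$ is a subgroup of the form $gA_Xg^{-1}$ with $X\subseteq Y$ and $g\in A_Y$. A set $X\subseteq V$ is called free of infinity if $\{v,w\}\in E$ for all distinct $v,w\in X$, and a complete parabolic subgroup of $A_\Gamma$ is a subgroup of the form $gA_Xg^{-1}$ with $g\in A_\Gamma$ and $X$ free of infinity. Theorem. Suppose that $A_\Gamma$ has the following property. (Int) For every $Y\subseteq V$ that is free of infinity and all parabolic subgroups $P_1,P_2$ of $A_Y$, the intersection $P_1\cap P_2$ is a parabolic subgroup of $A_\Gamma$.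 Then $A_\Gamma$ has the following property. (Int+$-$) For every complete parabolic subgroup $P_1$ of $A_\Gamma$ and every parabolic subgroup $P_2$ of $A_\Gamma$, the intersection $P_1\cap P_2$ is a parabolic subgroup of $A_\Gamma$. (The hypothesis (Int) holds in particular if, for every $Y$ that is free of infinity, the intersection of any two parabolic subgroups of $A_Y$ is a parabolic subgroup of $A_Y$.) -/

import Mathlib

namespace ArtinGroups

/-- The alternating product `a * b * a * ⋯` with exactly `n` letters, starting with `a`. -/
def altProd {G : Type*} [Group G] (a b : G) : ℕ → G
  | 0 => 1
  | n + 1 => a * altProd b a n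

variable {V : Type*} (Γ : SimpleGraph V) (m : Γ.edgeSet → ℕ)

/-- The relators of the Artin group of the edge-labelled graph `(Γ, m)`: for every edge `{v, w}`,
the quotient of the two alternating words in `v` and `w` with `m {v, w}` letters. -/
def artinRels : Set (FreeGroup V) :=
  {r | ∃ (v w : V) (h : Γ.Adj v w),
    r = altProd (FreeGroup.of v) (FreeGroup.of w) (m ⟨s(v, w), h⟩) *
      (altProd (FreeGroup.of w) (FreeGroup.of v) (m ⟨s(v, w), h⟩))⁻¹}

/-- The Artin group of the edge-labelled graph `(Γ, m)`: generators are the vertices, and there is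
a relation `v w v ⋯ = w v w ⋯` (with `m {v, w}` letters on each side) for every edge `{v, w}`. -/
abbrev ArtinGroup : Type _ := PresentedGroup (artinRels Γ m)

/-- The standard parabolic subgroup `A_X`, generated by the set `X` of vertices. -/
def standardParabolic (X : Set V) : Subgroup (ArtinGroup Γ m) :=
  Subgroup.closure ((PresentedGroup.of : V → ArtinGroup Γ m) '' X)

/-- The subgroup `g A_X g⁻¹`. -/
def conjParabolic (g : ArtinGroup Γ m) (X : Set V) : Subgroup (ArtinGroup Γ m) :=
  (standardParabolic Γ m X).map (MulAut.conj g).toMonoidHom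

/-- `P` is a parabolic subgroup of the whole Artin group. -/
def IsParabolic (P : Subgroup (ArtinGroup Γ m)) : Prop :=
  ∃ (X : Set V) (g : ArtinGroup Γ m), P = conjParabolic Γ m g X

/-- `P` is a parabolic subgroup of the standard parabolic subgroup `A_Y`: it is conjugate, by an
element of `A_Y`, to `A_X` for some `X ⊆ Y`. -/
def IsParabolicIn (Y : Set V) (P : Subgroup (ArtinGroup Γ m)) : Prop :=
  ∃ X ⊆ Y, ∃ g ∈ standardParabolic Γ m Y, P = conjParabolic Γ m g X

/-- A set of vertices is free of infinity if any two distinct elements of it are adjacent. -/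
def FreeOfInfinity (X : Set V) : Prop :=
  ∀ v ∈ X, ∀ w ∈ X, v ≠ w → Γ.Adj v w

/-- `P` is a complete parabolic subgroup: it is conjugate to `A_X` for some `X` free of
infinity. -/
def IsCompleteParabolic (P : Subgroup (ArtinGroup Γ m)) : Prop :=
  ∃ (X : Set V) (g : ArtinGroup Γ m), FreeOfInfinity Γ X ∧ P = conjParabolic Γ m g X

/-- Property (Int): for each set `Y` of vertices that is free of infinity, the intersection of any
two parabolic subgroups of `A_Y` is a parabolic subgroup (of the ambient Artin group; this is
implied by being a parabolic subgroup of `A_Y`). -/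
def PropertyInt : Prop :=
  ∀ Y : Set V, FreeOfInfinity Γ Y → ∀ P₁ P₂ : Subgroup (ArtinGroup Γ m),
    IsParabolicIn Γ m Y P₁ → IsParabolicIn Γ m Y P₂ → IsParabolic Γ m (P₁ ⊓ P₂)

/-- Property (Int+-): the intersection of a complete parabolic subgroup with an arbitrary parabolic
subgroup is a parabolic subgroup. -/
def PropertyIntPlusMinus : Prop :=
  ∀ P₁ P₂ : Subgroup (ArtinGroup Γ m),
    IsCompleteParabolic Γ m P₁ → IsParabolic Γ m P₂ → IsParabolic Γ m (P₁ ⊓ P₂)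

end ArtinGroups

/-! Fix `Z` containing `X` and `Y`, with both conjugators in A_Z, and induct on |Z|. If `Z` is free
of infinity, (Int) applies. Otherwise `Z` contains nonadjacent `v`, `w`, and A_Z is the amalgam of
A_{Z∖v} and A_{Z∖w} over K = A_{Z∖{v,w}}. Since X is free of infinity it misses `v` or `w`, so after
a conjugation P₁ lies in a factor. A second induction runs on the syllable length of the element g
in P₂ = gA_Yg⁻¹ (`isParabolic_inf_of_syllables`). If gA_Y has a shorter representative, use it; if
it has one of the same length that begins in the factor of P₁, conjugate the first syllable away.
Otherwise P₁ ∩ P₂ ≤ K: an element h of it outside K would give hg ∈ gA_Y, with alternating words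
that start in different factors. Then P₁ may be replaced by P₁ ∩ K, which is parabolic by the outer
induction, still complete, and contained in the other factor, where the first syllable of g can be
removed.

This needs A_X ∩ A_Y = A_{X∩Y} (`standardParabolic_inf`), and that a parabolic subgroup inside A_Y
is parabolic in A_Y, of a type that is free of infinity exactly when the old one is
(`exists_eq_conjParabolic_of_le`). Both come from a set-retraction A_Γ → A_X. The Artin group acts
on pairs of a chamber of the Coxeter group and a label in A_Γ: a letter crosses a wall, unless the
wall is a simple reflection from X, when the chamber stays and the label records the generator. The
braid relations for this action (`labelWalk_braid`) are checked in rank two residues, where only the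
two extreme walls can be simple. The tools for this are the exact orders of the products s_i s_j and
the parity of wall crossings. -/

namespace CoxeterMatrix

/-! ### The geometric representation and the orders of products of simple reflections. -/

open Module Polynomial.Chebyshev

variable {B : Type*} (M : CoxeterMatrix B)

/-- The linear form `v ↦ 2 ⟨e_i, v⟩` for the standard bilinear form of a Coxeter matrix. -/
noncomputable def geomForm (i : B) : Dual ℝ (B →₀ ℝ) :=
  -- If `M i j = 0` (no relation), division by zero gives cos 0 = 1, hence the value -2 that belongs
  -- to an infinite label.
  Finsupp.linearCombination ℝ fun j => -2 * Real.cos (Real.pi / M i j)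

theorem geomForm_single (i j : B) :
    M.geomForm i (Finsupp.single j 1) = -2 * Real.cos (Real.pi / M i j) := by
  simp [geomForm]

theorem geomForm_self (i : B) : M.geomForm i (Finsupp.single i 1) = 2 := by
  simp [geomForm_single]

/-- The simple reflections in the geometric representation. -/
noncomputable def geomReflection (i : B) : (B →₀ ℝ) ≃ₗ[ℝ] (B →₀ ℝ) :=
  reflection (M.geomForm_self i)

theorem two_le_of_ne {i j : B} (hij : i ≠ j) (h0 : M i j ≠ 0) : 2 ≤ M i j := by
  have := M.off_diagonal i j hij
  omega

theorem geomForm_mul_sub_two (i j : B) :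
    M.geomForm i (Finsupp.single j 1) * M.geomForm j (Finsupp.single i 1) - 2 =
      2 * Real.cos (2 * (Real.pi / M i j)) := by
  rw [geomForm_single, geomForm_single, M.symmetric j i, Real.cos_two_mul]
  ring

theorem sin_two_mul_pi_div_pos {m : ℕ} (hm : 3 ≤ m) : 0 < Real.sin (2 * (Real.pi / m)) := by
  have hm' : (3 : ℝ) ≤ m := by exact_mod_cast hm
  apply Real.sin_pos_of_pos_of_lt_pi
  · positivity
  · rw [← mul_div_assoc, div_lt_iff₀ (by linarith)]
    nlinarith [Real.pi_pos]

/-- Powers of a product of two reflections have Chebyshev coefficients, and S_n(2 cos φ) sin φ =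
sin((n+1)φ) with φ = 2π/m. Label 2 is treated apart because then sin φ = 0. -/
theorem isLiftable_geomReflection : M.IsLiftable M.geomReflection := by
  intro i j
  rcases eq_or_ne i j with rfl | hij
  · rw [M.diagonal, pow_one]
    refine LinearEquiv.ext fun v => ?_
    rw [LinearEquiv.mul_apply, LinearEquiv.coe_one, id]
    exact involutive_reflection (M.geomForm_self i) v
  rcases eq_or_ne (M i j) 0 with h0 | h0
  · rw [h0, pow_zero]
  have h2 := M.two_le_of_ne hij h0
  rcases h2.eq_or_lt with h2 | h3
  · rw [← h2]
    have hc : ∀ k l, M k l = 2 → M.geomForm k (Finsupp.single l 1) = 0 := by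
      intro k l h
      simp [geomForm_single, h]
    have h1 := hc i j h2.symm
    have h1' := hc j i (by rw [M.symmetric j i]; exact h2.symm)
    refine LinearEquiv.ext fun v => ?_
    rw [pow_two]
    simp only [LinearEquiv.mul_apply, geomReflection, reflection_apply, map_sub, map_smul, h1, h1',
      geomForm_self, LinearEquiv.coe_one, id]
    module
  · have hs := sin_two_mul_pi_div_pos h3
    have hmne : (M i j : ℝ) ≠ 0 := by exact_mod_cast h0
    have hθ : (M i j : ℝ) * (Real.pi / M i j) = Real.pi := by field_simp
    refine LinearEquiv.ext fun v => ?_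
    rw [geomReflection, geomReflection, reflection_mul_reflection_pow_apply _ _ _ _ _
      (M.geomForm_mul_sub_two i j).symm]
    have hS := fun n : ℤ => S_two_mul_real_cos (2 * (Real.pi / M i j)) n
    set θ := Real.pi / M i j
    -- The indices in the power formula are halves rounded down. For even m the common factor
    -- vanishes by sin π = 0, for odd m by sin(π - θ) + sin(θ + π) = 0.
    obtain ⟨k, hk | hk⟩ := Nat.even_or_odd' (M i j)
    · have e1 : ((M i j : ℤ) - 2) / 2 = k - 1 := by omega
      have e2 : ((M i j : ℤ) - 1) / 2 = k - 1 := by omega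
      have hz : (S ℝ (k - 1)).eval (2 * Real.cos (2 * θ)) = 0 := by
        have := hS (k - 1)
        rw [show ((((k : ℤ) - 1 : ℤ) : ℝ) + 1) * (2 * θ) = Real.pi by
          rw [← hθ, hk]; push_cast; ring, Real.sin_pi] at this
        exact (mul_eq_zero.mp this).resolve_right hs.ne'
      rw [e1, e2, hz]
      simp
    · have e1 : ((M i j : ℤ) - 2) / 2 = k - 1 := by omega
      have e2 : ((M i j : ℤ) - 1) / 2 = k := by omega
      have e3 : ((M i j : ℤ) - 3) / 2 = k - 1 := by omega
      have e4 : (M i j : ℤ) / 2 = k := by omega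
      have hz : (S ℝ k).eval (2 * Real.cos (2 * θ)) +
          (S ℝ (k - 1)).eval (2 * Real.cos (2 * θ)) = 0 := by
        have h1 := hS (k - 1)
        have h2 := hS k
        rw [hk] at hθ
        push_cast at h1 h2 hθ
        rw [show ((k : ℝ) - 1 + 1) * (2 * θ) = Real.pi - θ by linear_combination hθ,
          Real.sin_pi_sub] at h1
        rw [show ((k : ℝ) + 1) * (2 * θ) = θ + Real.pi by linear_combination hθ,
          Real.sin_add_pi] at h2
        have : ((S ℝ k).eval (2 * Real.cos (2 * θ)) +
          (S ℝ (k - 1)).eval (2 * Real.cos (2 * θ))) * Real.sin (2 * θ) = 0 := by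
          linear_combination h1 + h2
        exact (mul_eq_zero.mp this).resolve_right hs.ne'
      rw [e1, e2, e3, e4, hz]
      simp

/-- Compare the coordinates of e_i and of its image under the k-th power: for finite m ≥ 3 they
force cos(kφ) = 1 with φ = 2π/m. -/
theorem dvd_of_geomReflection_pow_eq_one {i j : B} (hij : i ≠ j) {k : ℕ}
    (hk : (M.geomReflection i * M.geomReflection j) ^ k = 1) : M i j ∣ k := by
  have key := reflection_mul_reflection_pow_apply_self (M.geomForm_self i) (M.geomForm_self j) k
    _ (M.geomForm_mul_sub_two i j).symm
  rw [show (reflection (M.geomForm_self i) * reflection (M.geomForm_self j)) ^ k = 1 from hk]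
    at key
  have ci := congrArg (fun v => v i) key
  have cj := congrArg (fun v => v j) key
  simp [hij, hij.symm, M.geomForm_single, M.symmetric j i] at ci cj
  rcases eq_or_ne (M i j) 0 with h0 | h0
  -- Here the angle is 0 and S_{k-1}(2) = k, so the second coordinate gives k = 0.
  · simp [h0] at ci cj ⊢
    exact cj
  rcases (M.two_le_of_ne hij h0).eq_or_lt with h2 | h3
  -- Now `cj` is void since cos(π/2) = 0, while `ci` says (-1)^k = 1.
  · rw [← h2] at ci cj ⊢
    push_cast at ci
    rw [show 2 * (Real.pi / 2) = Real.pi by ring, Real.cos_pi,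
      show (2 : ℝ) * -1 = -2 by norm_num, S_eval_neg_two, S_eval_neg_two] at ci
    rcases Nat.even_or_odd k with hk | hk
    · exact hk.two_dvd
    · exfalso
      have e1 : Int.negOnePow (k : ℤ) = -1 := Int.negOnePow_odd _ (by exact_mod_cast hk)
      have e2 : Int.negOnePow ((k : ℤ) - 1) = 1 :=
        Int.negOnePow_even _ (by
          have : Odd (k : ℤ) := by exact_mod_cast hk
          exact this.sub_odd odd_one)
      rw [e1, e2] at ci
      push_cast at ci
      norm_num at ci
  · have hs := sin_two_mul_pi_div_pos h3
    have hS := fun n : ℤ => S_two_mul_real_cos (2 * (Real.pi / M i j)) n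
    have hm3 : (3 : ℝ) ≤ M i j := by exact_mod_cast h3
    have hcos : Real.cos (Real.pi / M i j) ≠ 0 := by
      apply ne_of_gt
      apply Real.cos_pos_of_mem_Ioo
      constructor
      · have : 0 < Real.pi / M i j := by positivity
        linarith [Real.pi_pos]
      · rw [div_lt_div_iff₀ (by linarith) (by norm_num)]
        nlinarith [Real.pi_pos]
    have hz := cj.resolve_right hcos
    rw [hz, add_zero] at ci
    have h1 := hS (k - 1)
    have h2 := hS k
    rw [hz] at h1
    rw [← ci] at h2
    push_cast at h1 h2
    rw [sub_add_cancel, zero_mul] at h1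
    rw [add_mul, one_mul, one_mul, Real.sin_add, ← h1, zero_mul, zero_add] at h2
    have hc : Real.cos (k * (2 * (Real.pi / M i j))) = 1 := by
      have := mul_right_cancel₀ hs.ne' (h2.symm.trans (one_mul _).symm)
      exact this
    obtain ⟨l, hl⟩ := (Real.cos_eq_one_iff _).mp hc
    have hp := Real.pi_pos.ne'
    have hm0 : (M i j : ℝ) ≠ 0 := by linarith
    field_simp at hl
    have : (k : ℤ) = M i j * l := by
      have : (k : ℝ) = M i j * l := by linarith
      exact_mod_cast this
    exact_mod_cast Dvd.intro _ this.symm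

end CoxeterMatrix

namespace CoxeterSystem

variable {B W : Type*} [Group W] {M : CoxeterMatrix B} (cs : CoxeterSystem M W)

theorem orderOf_simple_mul_simple (i j : B) :
    orderOf (cs.simple i * cs.simple j) = M i j := by
  rcases eq_or_ne i j with rfl | hij
  · simp
  apply Nat.dvd_antisymm
  · exact orderOf_dvd_of_pow_eq_one (cs.simple_mul_simple_pow i j)
  · apply M.dvd_of_geomReflection_pow_eq_one hij
    have := congrArg (cs.lift ⟨_, M.isLiftable_geomReflection⟩)
      (pow_orderOf_eq_one (cs.simple i * cs.simple j))
    rwa [map_pow, map_mul, cs.lift_apply_simple, cs.lift_apply_simple, map_one] at this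

theorem simple_injective : Function.Injective cs.simple := by
  intro i j h
  by_contra hij
  apply M.off_diagonal i j hij
  rw [← cs.orderOf_simple_mul_simple i j, h, cs.simple_mul_simple_self, orderOf_one]

end CoxeterSystem

/-! ### The parity of wall crossings. -/

namespace CoxeterSystem

variable {B W : Type*} [Group W] {M : CoxeterMatrix B} (cs : CoxeterSystem M W)

open scoped Classical in
/-- The action of a simple reflection on signed group elements: conjugation, with a change of
sign exactly at the simple reflection itself. -/
noncomputable def signedConj (i : B) : Equiv.Perm (W × ZMod 2) :=
  Function.Involutive.toPerm
    (fun p => (cs.simple i * p.1 * cs.simple i, p.2 + if p.1 = cs.simple i then 1 else 0)) <| by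
    rintro ⟨t, ε⟩
    have h : cs.simple i * t * cs.simple i = cs.simple i ↔ t = cs.simple i := by
      constructor
      · intro h
        have := congrArg (fun x => cs.simple i * x * cs.simple i) h
        simpa [mul_assoc] using this
      · rintro rfl
        simp
    ext
    · simp [mul_assoc]
    · simp only [h, add_assoc, CharTwo.add_self_eq_zero, add_zero]

open scoped Classical in
theorem signedConj_apply (i : B) (t : W) (ε : ZMod 2) :
    cs.signedConj i (t, ε) =
      (cs.simple i * t * cs.simple i, ε + if t = cs.simple i then 1 else 0) := rfl

open scoped Classical in
theorem signedConj_mul_pow_apply (i j : B) (k : ℕ) (t : W) (ε : ZMod 2) :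
    ((cs.signedConj i * cs.signedConj j) ^ k) (t, ε) =
      ((cs.simple i * cs.simple j) ^ k * t * ((cs.simple i * cs.simple j) ^ k)⁻¹,
        ε + ∑ l ∈ Finset.range (2 * k),
          if t = cs.simple j * (cs.simple i * cs.simple j) ^ l then 1 else 0) := by
  have hinv : (cs.simple i * cs.simple j)⁻¹ = cs.simple j * cs.simple i := by simp
  have comm : ∀ l : ℕ, ((cs.simple i * cs.simple j) ^ l)⁻¹ * cs.simple j =
      cs.simple j * (cs.simple i * cs.simple j) ^ l := by
    intro l
    rw [← inv_pow, hinv]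
    have h : SemiconjBy (cs.simple j) (cs.simple i * cs.simple j) (cs.simple j * cs.simple i) :=
      (mul_assoc _ _ _).symm
    exact (h.pow_right l).eq.symm
  induction k with
  | zero => simp
  | succ k ih =>
    rw [pow_succ', Equiv.Perm.mul_apply, ih, Equiv.Perm.mul_apply, signedConj_apply,
      signedConj_apply]
    have h1 : ∀ u : W, (cs.simple i * cs.simple j) ^ k * t * ((cs.simple i * cs.simple j) ^ k)⁻¹ = u
        ↔ t = ((cs.simple i * cs.simple j) ^ k)⁻¹ * u * (cs.simple i * cs.simple j) ^ k := by
      intro u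
      rw [mul_inv_eq_iff_eq_mul, mul_assoc, eq_inv_mul_iff_mul_eq]
    have h2 : ∀ u : W, cs.simple j * u * cs.simple j = cs.simple i ↔
        u = cs.simple j * cs.simple i * cs.simple j := by
      intro u
      constructor
      · intro h
        rw [← h]
        simp [mul_assoc]
      · rintro rfl
        simp [mul_assoc]
    simp only [h2, h1]
    rw [show 2 * (k + 1) = 2 * k + 1 + 1 by ring, Finset.sum_range_succ, Finset.sum_range_succ]
    ext
    · simp [pow_succ', mul_assoc]
    · have e1 : ((cs.simple i * cs.simple j) ^ k)⁻¹ * cs.simple j * (cs.simple i * cs.simple j) ^ k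
          = cs.simple j * (cs.simple i * cs.simple j) ^ (2 * k) := by
        rw [comm, mul_assoc, ← pow_add, two_mul]
      have e2 : ((cs.simple i * cs.simple j) ^ k)⁻¹ * (cs.simple j * cs.simple i * cs.simple j) *
          (cs.simple i * cs.simple j) ^ k
          = cs.simple j * (cs.simple i * cs.simple j) ^ (2 * k + 1) := by
        rw [mul_assoc (cs.simple j), ← mul_assoc _ (cs.simple j), comm, mul_assoc, mul_assoc,
          ← pow_succ', ← pow_add]
        congr 2
        ring
      simp only [e1, e2, add_assoc]

/-- The sign change is a sum over 2m indices. As (s_i s_j)^m = 1, its second half repeats the first,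
and the sum vanishes mod 2. -/
theorem isLiftable_signedConj : M.IsLiftable cs.signedConj := by
  classical
  intro i j
  have hm := cs.simple_mul_simple_pow i j
  refine Equiv.ext fun ⟨t, ε⟩ => ?_
  rw [signedConj_mul_pow_apply, hm, two_mul, Finset.sum_range_add]
  simp only [pow_add, hm, one_mul, CharTwo.add_self_eq_zero, add_zero, inv_one, mul_one]
  rfl

/-- The action of a Coxeter group on its signed elements. -/
noncomputable def signedConjHom : W →* Equiv.Perm (W × ZMod 2) :=
  cs.lift ⟨_, cs.isLiftable_signedConj⟩

/-- The parity of the number of times that a gallery from the identity to `w` crosses the wall of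
the reflection `t`. -/
noncomputable def crossing (w t : W) : ZMod 2 := (cs.signedConjHom w⁻¹ (t, 0)).2

theorem signedConjHom_apply (w t : W) (ε : ZMod 2) :
    cs.signedConjHom w (t, ε) = (w * t * w⁻¹, ε + cs.crossing w⁻¹ t) := by
  have key : ∀ w : W, ∀ (t : W) (ε : ZMod 2), (cs.signedConjHom w (t, ε)).1 = w * t * w⁻¹ ∧
      (cs.signedConjHom w (t, ε)).2 = ε + (cs.signedConjHom w (t, 0)).2 := by
    intro w
    induction w using cs.simple_induction_left with
    | one => simp
    | mul_simple_left w i ih =>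
      intro t ε
      rw [map_mul, Equiv.Perm.mul_apply, Equiv.Perm.mul_apply]
      obtain ⟨h1, h2⟩ := ih t ε
      obtain ⟨h3, -⟩ := ih t 0
      rw [← Prod.mk.eta (p := cs.signedConjHom w (t, ε)),
        ← Prod.mk.eta (p := cs.signedConjHom w (t, 0)), h1, h2, h3]
      simp only [signedConjHom, lift_apply_simple, signedConj_apply]
      constructor
      · simp [mul_assoc]
      · rw [add_assoc]
  ext
  · exact (key w t ε).1
  · rw [crossing, inv_inv]
    exact (key w t ε).2

theorem crossing_one (t : W) : cs.crossing 1 t = 0 := by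
  simp [crossing]

/-- A gallery to `u * v` is a gallery to `u` followed by the `u`-translate of a gallery to `v`. -/
theorem crossing_mul (u v t : W) :
    cs.crossing (u * v) t = cs.crossing u t + cs.crossing v (u⁻¹ * t * u) := by
  rw [crossing, mul_inv_rev, map_mul, Equiv.Perm.mul_apply, signedConjHom_apply,
    signedConjHom_apply]
  simp

open scoped Classical in
theorem crossing_simple (i : B) (t : W) :
    cs.crossing (cs.simple i) t = if t = cs.simple i then 1 else 0 := by
  simp [crossing, signedConjHom, signedConj_apply]

open scoped Classical in
theorem crossing_mul_simple (w : W) (i : B) (t : W) :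
    cs.crossing (w * cs.simple i) t =
      cs.crossing w t + if t = w * cs.simple i * w⁻¹ then 1 else 0 := by
  rw [crossing_mul, crossing_simple]
  congr 2
  rw [eq_mul_inv_iff_mul_eq, mul_assoc, inv_mul_eq_iff_eq_mul]

/-- An odd number of crossings puts `t` in the left inversion sequence of every word for `w`, in
particular of a reduced one. -/
theorem length_mul_lt_of_crossing_ne_zero {w t : W} (h : cs.crossing w t ≠ 0) :
    cs.length (t * w) < cs.length w := by
  obtain ⟨ω, hω, rfl⟩ := cs.exists_isReduced w
  have mem : ∀ ω : List B, cs.crossing (cs.wordProd ω) t ≠ 0 → t ∈ cs.leftInvSeq ω := by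
    intro ω
    induction ω using List.reverseRecOn with
    | nil => simp [crossing_one]
    | append_singleton ω i ih =>
      classical
      intro h
      rw [wordProd_append, wordProd_singleton, crossing_mul_simple] at h
      rw [← List.concat_eq_append, leftInvSeq_concat, List.concat_eq_append, List.mem_append,
        List.mem_singleton]
      by_cases h' : t = cs.wordProd ω * cs.simple i * (cs.wordProd ω)⁻¹
      · exact Or.inr h'
      · rw [if_neg h', add_zero] at h
        exact Or.inl (ih h)
  exact (cs.isLeftInversion_of_mem_leftInvSeq hω (mem ω h)).2

end CoxeterSystem

/-! ### Dihedral galleries and minimal chambers of rank two residues. -/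

namespace CoxeterSystem

variable {B W : Type*} [Group W] {M : CoxeterMatrix B} (cs : CoxeterSystem M W)

/-- The alternating sequence `i, j, i, j, …`. -/
def alternate {α : Type*} (i j : α) (k : ℕ) : α := if Even k then i else j

theorem alternate_add_one {α : Type*} (i j : α) (k : ℕ) :
    alternate i j (k + 1) = alternate j i k := by
  simp only [alternate, Nat.even_add_one]
  split_ifs <;> rfl

theorem alternate_congr {α : Type*} (i j : α) {k l : ℕ} (h : Even (k + l)) :
    alternate i j k = alternate i j l := by
  rw [Nat.even_add] at h
  simp only [alternate, h]

/-- The chambers of the gallery that starts at the identity and crosses alternately walls of type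
`i` and `j`. -/
def gallery (i j : B) : ℕ → W
  | 0 => 1
  | k + 1 => gallery i j k * cs.simple (alternate i j k)

/-- The reflection in the wall between two consecutive chambers of a gallery. -/
def galleryWall (i j : B) (k : ℕ) : W := (cs.simple i * cs.simple j) ^ k * cs.simple i

variable (i j : B)

theorem gallery_succ (k : ℕ) :
    cs.gallery i j (k + 1) = cs.gallery i j k * cs.simple (alternate i j k) := rfl

theorem gallery_two_mul (k : ℕ) :
    cs.gallery i j (2 * k) = (cs.simple i * cs.simple j) ^ k := by
  induction k with
  | zero => simp [gallery]
  | succ k ih =>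
    rw [show 2 * (k + 1) = 2 * k + 1 + 1 by ring, gallery_succ, gallery_succ, ih, pow_succ]
    simp [alternate, mul_assoc]

theorem gallery_two_mul_add_one (k : ℕ) :
    cs.gallery i j (2 * k + 1) = (cs.simple i * cs.simple j) ^ k * cs.simple i := by
  rw [gallery_succ, gallery_two_mul]
  simp [alternate]

theorem simple_mul_pow (k : ℕ) :
    cs.simple i * ((cs.simple i * cs.simple j) ^ k)⁻¹ =
      (cs.simple i * cs.simple j) ^ k * cs.simple i := by
  rw [← inv_pow, mul_inv_rev, inv_simple, inv_simple]
  have h : SemiconjBy (cs.simple i) (cs.simple j * cs.simple i) (cs.simple i * cs.simple j) :=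
    (mul_assoc _ _ _).symm
  exact (h.pow_right k).eq

theorem gallery_conj (k : ℕ) :
    cs.gallery i j k * cs.simple (alternate i j k) * (cs.gallery i j k)⁻¹ =
      cs.galleryWall i j k := by
  obtain ⟨l, rfl | rfl⟩ := Nat.even_or_odd' k
  · rw [gallery_two_mul, galleryWall]
    simp only [alternate, even_two, Even.mul_right, if_true]
    rw [mul_assoc, simple_mul_pow, ← mul_assoc, ← pow_add, two_mul]
  · rw [gallery_two_mul_add_one, galleryWall]
    simp only [alternate, Nat.not_even_bit1, if_false, mul_inv_rev, inv_simple]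
    rw [mul_assoc, mul_assoc, ← mul_assoc (cs.simple j), ← mul_assoc (cs.simple i) _ (_)⁻¹,
      ← mul_assoc (cs.simple i) (cs.simple j), mul_assoc _ (cs.simple i), simple_mul_pow,
      ← mul_assoc, ← mul_assoc, ← pow_succ, ← pow_add]
    congr 2
    ring

theorem galleryWall_mul_gallery (k : ℕ) :
    cs.galleryWall i j k * cs.gallery i j k = cs.gallery i j (k + 1) := by
  rw [← gallery_conj, inv_mul_cancel_right, gallery_succ]

theorem galleryWall_zero : cs.galleryWall i j 0 = cs.simple i := by
  simp [galleryWall]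

theorem galleryWall_conj (k : ℕ) :
    cs.galleryWall i j (k + 1) * cs.galleryWall i j k * cs.galleryWall i j (k + 1) =
      cs.galleryWall i j (k + 2) := by
  have h : cs.galleryWall i j k * cs.galleryWall i j (k + 1) =
      (cs.simple i * cs.simple j)⁻¹ := by
    have := cs.simple_mul_pow i j (k + 1)
    rw [galleryWall, galleryWall, ← this, mul_assoc, simple_mul_simple_cancel_left, pow_succ',
      mul_inv_rev, mul_inv_cancel_left]
  have h' : cs.galleryWall i j (k + 1) * (cs.simple i * cs.simple j)⁻¹ =
      cs.galleryWall i j (k + 2) := by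
    rw [galleryWall, galleryWall, mul_inv_rev, inv_simple, inv_simple, pow_succ _ (k + 1)]
    simp only [mul_assoc]
  rw [mul_assoc, h, h']

theorem galleryWall_mod (k : ℕ) : cs.galleryWall i j (k % M i j) = cs.galleryWall i j k := by
  simp only [galleryWall]
  rw [← cs.orderOf_simple_mul_simple, pow_mod_orderOf]

theorem galleryWall_eq_iff {k l : ℕ} :
    cs.galleryWall i j k = cs.galleryWall i j l ↔ k ≡ l [MOD M i j] := by
  rw [galleryWall, galleryWall, mul_left_inj, pow_eq_pow_iff_modEq, orderOf_simple_mul_simple]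

theorem gallery_add_two_mul_order (k : ℕ) :
    cs.gallery i j (k + 2 * M i j) = cs.gallery i j k := by
  have hm := cs.simple_mul_simple_pow i j
  obtain ⟨l, rfl | rfl⟩ := Nat.even_or_odd' k
  · rw [← mul_add, gallery_two_mul, gallery_two_mul, pow_add, hm, mul_one]
  · rw [add_right_comm, ← mul_add, gallery_two_mul_add_one, gallery_two_mul_add_one, pow_add, hm,
      mul_one]

theorem gallery_mod (k : ℕ) : cs.gallery i j (k % (2 * M i j)) = cs.gallery i j k := by
  conv_rhs => rw [← Nat.mod_add_div k (2 * M i j)]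
  induction k / (2 * M i j) with
  | zero => rfl
  | succ n ih => rw [mul_add, mul_one, ← add_assoc, gallery_add_two_mul_order, ih]

theorem gallery_mul_simple_pred (k : ℕ) :
    cs.gallery i j (k + 1) * cs.simple (alternate i j k) = cs.gallery i j k := by
  rw [gallery_succ, mul_assoc, simple_mul_simple_self, mul_one]

variable {i j}

theorem galleryWall_last (h0 : M i j ≠ 0) : cs.galleryWall i j (M i j - 1) = cs.simple j := by
  have h : (cs.simple i * cs.simple j) ^ (M i j - 1) * (cs.simple i * cs.simple j) = 1 := by
    rw [← pow_succ, Nat.sub_add_cancel (Nat.pos_of_ne_zero h0), simple_mul_simple_pow]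
  rw [galleryWall, eq_mul_inv_of_mul_eq h]
  simp

theorem galleryWall_swap (h0 : M i j ≠ 0) {k : ℕ} (hk : k < M i j) :
    cs.galleryWall j i k = cs.galleryWall i j (M i j - 1 - k) := by
  have h : (cs.simple j * cs.simple i) = (cs.simple i * cs.simple j)⁻¹ := by simp
  have h' : cs.galleryWall j i k =
      (cs.simple i * cs.simple j)⁻¹ ^ k * cs.galleryWall i j (M i j - 1) := by
    rw [galleryWall, h, cs.galleryWall_last h0]
  rw [h', galleryWall, galleryWall, ← mul_assoc]
  congr 1
  rw [inv_pow, inv_mul_eq_iff_eq_mul, ← pow_add]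
  congr 1
  omega

variable (i j) in
theorem gallery_order_eq :
    cs.gallery i j (M i j) = cs.gallery j i (M i j) := by
  -- The gallery of length 2m is closed; read backwards it is the gallery of the other type.
  have key : ∀ k ≤ 2 * M i j, cs.gallery j i k = cs.gallery i j (2 * M i j - k) := by
    intro k
    induction k with
    | zero =>
      intro _
      rw [Nat.sub_zero, gallery_two_mul, simple_mul_simple_pow]
      rfl
    | succ k ih =>
      intro hk
      rw [gallery_succ, ih (by omega), ← alternate_add_one,
        show 2 * M i j - k = 2 * M i j - (k + 1) + 1 by omega,
        alternate_congr (l := 2 * M i j - (k + 1)) i j, gallery_mul_simple_pred]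
      rw [show k + 1 + (2 * M i j - (k + 1)) = 2 * M i j by omega]
      exact even_two_mul _
  rw [key (M i j) (by omega)]
  congr 1
  omega

open scoped Classical in
theorem crossing_gallery (k : ℕ) (t : W) :
    cs.crossing (cs.gallery i j k) t =
      ∑ q ∈ Finset.range k, if t = cs.galleryWall i j q then 1 else 0 := by
  induction k with
  | zero => exact cs.crossing_one t
  | succ k ih => rw [gallery_succ, crossing_mul_simple, ih, Finset.sum_range_succ, gallery_conj]

/-- Walls recur with period exactly m, so wall `l` is not met a second time during the first m + l
steps. -/
theorem crossing_gallery_galleryWall {k l : ℕ} (hl : l < M i j) (hk : k ≤ M i j + l) :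
    cs.crossing (cs.gallery i j k) (cs.galleryWall i j l) = if l < k then 1 else 0 := by
  classical
  rw [crossing_gallery]
  have : ∀ q ∈ Finset.range k, (if cs.galleryWall i j l = cs.galleryWall i j q then (1 : ZMod 2)
      else 0) = if q = l then 1 else 0 := by
    intro q hq
    rw [Finset.mem_range] at hq
    congr 1
    rw [galleryWall_eq_iff, eq_iff_iff]
    constructor
    · intro h
      rcases lt_trichotomy q l with h' | h' | h'
      · exact Nat.ModEq.eq_of_lt_of_lt h.symm (h'.trans hl) hl
      · exact h'
      · have := Nat.le_of_dvd (by omega) ((Nat.modEq_iff_dvd' h'.le).mp h)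
        omega
    · rintro rfl
      rfl
  rw [Finset.sum_congr rfl this, Finset.sum_ite_eq']
  simp

variable (i j) in
/-- The dihedral subgroup generated by two simple reflections. -/
def dihedral : Subgroup W := Subgroup.closure {cs.simple i, cs.simple j}

theorem dihedral_comm : cs.dihedral i j = cs.dihedral j i := by
  rw [dihedral, Set.pair_comm, dihedral]

variable (i j) in
theorem simple_left_mem_dihedral : cs.simple i ∈ cs.dihedral i j :=
  Subgroup.subset_closure (by simp)

variable (i j) in
theorem simple_right_mem_dihedral : cs.simple j ∈ cs.dihedral i j :=
  Subgroup.subset_closure (by simp)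

variable (i j) in
theorem galleryWall_mem_dihedral (k : ℕ) : cs.galleryWall i j k ∈ cs.dihedral i j :=
  mul_mem (pow_mem (mul_mem (cs.simple_left_mem_dihedral i j) (cs.simple_right_mem_dihedral i j)) _)
    (cs.simple_left_mem_dihedral i j)

theorem exists_gallery_eq (h0 : M i j ≠ 0) {u : W} (hu : u ∈ cs.dihedral i j) :
    ∃ k < 2 * M i j, u = cs.gallery i j k := by
  suffices ∃ k, u = cs.gallery i j k by
    obtain ⟨k, hk⟩ := this
    exact ⟨k % (2 * M i j), Nat.mod_lt _ (by omega), by rw [gallery_mod, hk]⟩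
  have step : ∀ l, l = i ∨ l = j → ∀ k, ∃ k', cs.gallery i j k * cs.simple l =
      cs.gallery i j k' := by
    intro l hl k
    by_cases h : l = alternate i j k
    · exact ⟨k + 1, by rw [gallery_succ, h]⟩
    -- Going back one step is going to index k + 2m - 1, which also makes sense for k = 0.
    · have : l = alternate i j (k + 2 * M i j - 1) := by
        rw [alternate_congr (l := k + 1) i j, alternate_add_one]
        · unfold alternate at h ⊢
          split_ifs at h ⊢
          · exact hl.resolve_left h
          · exact hl.resolve_right h
        · rw [show k + 2 * M i j - 1 + (k + 1) = 2 * (k + M i j) by omega]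
          exact even_two_mul _
      refine ⟨k + 2 * M i j - 1, ?_⟩
      rw [← cs.gallery_add_two_mul_order i j k, this]
      conv_lhs => rw [show k + 2 * M i j = k + 2 * M i j - 1 + 1 by omega]
      rw [Nat.add_sub_cancel, gallery_mul_simple_pred]
  induction hu using Subgroup.closure_induction_right with
  | one => exact ⟨0, rfl⟩
  | mul_right x _ y hy ih =>
    obtain ⟨k, rfl⟩ := ih
    rcases hy with rfl | rfl
    · exact step i (Or.inl rfl) k
    · exact step j (Or.inr rfl) k
  | mul_inv_cancel x _ y hy ih =>
    obtain ⟨k, rfl⟩ := ih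
    rcases hy with rfl | rfl
    · rw [inv_simple]
      exact step i (Or.inl rfl) k
    · rw [inv_simple]
      exact step j (Or.inr rfl) k

/-- The chamber `d` is closest to the identity among the chambers of its residue of type
`{i, j}`. -/
def IsResidueMin (i j : B) (d : W) : Prop :=
  ∀ u ∈ cs.dihedral i j, cs.crossing d (d * u * d⁻¹) = 0

theorem IsResidueMin.symm {d : W} (h : cs.IsResidueMin i j d) : cs.IsResidueMin j i d := by
  intro u hu
  rw [← dihedral_comm] at hu
  exact h u hu

-- Take `d` shortest in the coset: a crossed wall d u d⁻¹ of the residue would make d u a shorter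
-- element of the same coset.
variable (i j) in
theorem exists_isResidueMin (w : W) :
    ∃ d, cs.IsResidueMin i j d ∧ d⁻¹ * w ∈ cs.dihedral i j := by
  classical
  let P : ℕ → Prop := fun n => ∃ d, cs.length d = n ∧ d⁻¹ * w ∈ cs.dihedral i j
  have hP : ∃ n, P n := ⟨_, w, rfl, by rw [inv_mul_cancel]; exact one_mem _⟩
  obtain ⟨d, hd, hdw⟩ := Nat.find_spec hP
  refine ⟨d, fun u hu => ?_, hdw⟩
  by_contra h
  have hlt := cs.length_mul_lt_of_crossing_ne_zero h
  rw [inv_mul_cancel_right, hd] at hlt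
  refine Nat.find_min hP hlt ⟨_, rfl, ?_⟩
  rw [mul_inv_rev, mul_assoc]
  exact mul_mem (inv_mem hu) hdw

variable {cs}

theorem IsResidueMin.crossing_mul {d : W} (hd : cs.IsResidueMin i j d) {u t : W}
    (ht : t ∈ cs.dihedral i j) :
    cs.crossing (d * u) (d * t * d⁻¹) = cs.crossing u t := by
  rw [CoxeterSystem.crossing_mul, hd t ht, zero_add]
  simp [mul_assoc]

/-- Only the first and the last wall of a minimal residue can be of simple type. -/
theorem IsResidueMin.simple_wall {d : W} (hd : cs.IsResidueMin i j d) {q : ℕ} (hq : q < M i j)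
    {x : B} (hx : cs.simple x = d * cs.galleryWall i j q * d⁻¹) : q = 0 ∨ q = M i j - 1 := by
  classical
  by_contra! h
  obtain ⟨l, rfl⟩ := Nat.exists_eq_succ_of_ne_zero h.1
  have hmem := cs.galleryWall_mem_dihedral i j
  have hl : l + 2 < M i j := by
    have := h.2
    omega
  -- The reflection in wall l + 1 exchanges chambers l + 1 and l + 2, and walls l and l + 2. Being
  -- simple, it transports the crossing parities of all walls but its own. Yet wall l is crossed on
  -- the way to chamber l + 2, and wall l + 2 is not crossed on the way to chamber l + 1.
  have e1 : cs.simple x * (d * cs.gallery i j (l + 1)) = d * cs.gallery i j (l + 2) := by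
    rw [hx, ← cs.galleryWall_mul_gallery i j (l + 1)]
    simp [mul_assoc]
  have c1 : cs.crossing (d * cs.gallery i j (l + 2)) (d * cs.galleryWall i j l * d⁻¹) = 1 := by
    rw [hd.crossing_mul (hmem _), crossing_gallery_galleryWall _ (by omega) (by omega),
      if_pos (by omega)]
  have e2 : (cs.simple x)⁻¹ * (d * cs.galleryWall i j l * d⁻¹) * cs.simple x =
      d * cs.galleryWall i j (l + 2) * d⁻¹ := by
    rw [inv_simple, hx, ← galleryWall_conj]
    simp [mul_assoc]
  rw [← e1, CoxeterSystem.crossing_mul, crossing_simple, e2, hd.crossing_mul (hmem _),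
    crossing_gallery_galleryWall _ hl (by omega), if_neg (by omega : ¬ l + 2 < l + 1), if_neg] at c1
  · simp at c1
  · rw [hx, mul_left_inj, mul_right_inj, galleryWall_eq_iff]
    intro h
    have := Nat.ModEq.eq_of_lt_of_lt h (by omega) hq
    omega

end CoxeterSystem

/-! ### Label walks and their braid relations. -/

namespace CoxeterSystem

variable {B W : Type*} [Group W] {M : CoxeterMatrix B} (cs : CoxeterSystem M W)
variable {A : Type*} [Group A]

open ArtinGroups (altProd)

/-- `w` has minimal length in its left coset of the standard parabolic subgroup of type `X`. -/
def IsMinimal (X : Set B) (w : W) : Prop := ∀ x ∈ X, cs.crossing w (cs.simple x) = 0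

open scoped Classical in
/-- One step of the set-retraction: move through the wall of type `i`, unless that wall has
simple type in `X`, in which case stay and record the label of the wall. -/
noncomputable def labelStep (X : Set B) (τ : W → A) (i : B) (p : W × A) : W × A :=
  if p.1 * cs.simple i * p.1⁻¹ ∈ cs.simple '' X then (p.1, τ (p.1 * cs.simple i * p.1⁻¹) * p.2)
  else (p.1 * cs.simple i, p.2)

variable (X : Set B) (τ : W → A)

/-- The first `n` steps along a sequence of types. -/
noncomputable def labelWalk (f : ℕ → B) : ℕ → W × A → W × A
  | 0, p => p
  | n + 1, p => cs.labelStep X τ (f n) (labelWalk f n p)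

variable {X τ}

theorem labelStep_stay {i : B} {u : W} {a : A} (h : u * cs.simple i * u⁻¹ ∈ cs.simple '' X) :
    cs.labelStep X τ i (u, a) = (u, τ (u * cs.simple i * u⁻¹) * a) := if_pos h

theorem labelStep_move {i : B} {u : W} {a : A} (h : u * cs.simple i * u⁻¹ ∉ cs.simple '' X) :
    cs.labelStep X τ i (u, a) = (u * cs.simple i, a) := if_neg h

theorem labelWalk_eq_of_step {f : ℕ → B} {F : ℕ → W × A}
    (hF : ∀ n, F (n + 1) = cs.labelStep X τ (f n) (F n)) (n : ℕ) :
    cs.labelWalk X τ f n (F 0) = F n := by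
  induction n with
  | zero => rfl
  | succ n ih => rw [labelWalk, ih, hF]

variable {cs} {i j : B}

theorem IsMinimal.move {w : W} (hw : cs.IsMinimal X w)
    (h : w * cs.simple i * w⁻¹ ∉ cs.simple '' X) : cs.IsMinimal X (w * cs.simple i) := by
  classical
  intro x hx
  rw [crossing_mul_simple, hw x hx, if_neg, add_zero]
  intro h'
  exact h ⟨x, hx, h'⟩

theorem IsMinimal.labelStep {p : W × A} (hp : cs.IsMinimal X p.1) :
    cs.IsMinimal X (cs.labelStep X τ i p).1 := by
  obtain ⟨u, a⟩ := p
  by_cases h : u * cs.simple i * u⁻¹ ∈ cs.simple '' X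
  · rwa [labelStep_stay _ h]
  · rw [labelStep_move _ h]
    exact hp.move h

theorem alternate_mem {α : Type*} (i j : α) (k : ℕ) :
    alternate i j k = i ∨ alternate i j k = j := by
  unfold alternate
  split_ifs <;> simp

theorem exists_galleryWall_eq (h0 : M i j ≠ 0) {u : W} (hu : u ∈ cs.dihedral i j) {l : B}
    (hl : l = i ∨ l = j) : ∃ q < M i j, u * cs.simple l * u⁻¹ = cs.galleryWall i j q := by
  suffices ∃ q, u * cs.simple l * u⁻¹ = cs.galleryWall i j q by
    obtain ⟨q, hq⟩ := this
    exact ⟨q % M i j, Nat.mod_lt _ (Nat.pos_of_ne_zero h0), by rw [galleryWall_mod, hq]⟩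
  obtain ⟨k, -, rfl⟩ := cs.exists_gallery_eq h0 hu
  by_cases h : l = alternate i j k
  · exact ⟨k, by rw [h, gallery_conj]⟩
  · have hl' : l = alternate i j (k + 2 * M i j - 1) := by
      rw [alternate_congr (l := k + 1) i j, alternate_add_one]
      · unfold alternate at h ⊢
        split_ifs at h ⊢
        · exact hl.resolve_left h
        · exact hl.resolve_right h
      · rw [show k + 2 * M i j - 1 + (k + 1) = 2 * (k + M i j) by omega]
        exact even_two_mul _
    refine ⟨k + 2 * M i j - 1, ?_⟩
    rw [← cs.gallery_add_two_mul_order i j k, hl', ← gallery_conj]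
    rw [show k + 2 * M i j = k + 2 * M i j - 1 + 1 by omega, Nat.add_sub_cancel, gallery_succ]
    simp [mul_assoc]

/-- Braid relation for walks in a residue without walls of simple type in `X`. -/
theorem labelWalk_braid_of_no_wall (h0 : M i j ≠ 0) {d w : W} (a : A)
    (hdw : d⁻¹ * w ∈ cs.dihedral i j)
    (hX : ∀ q < M i j, d * cs.galleryWall i j q * d⁻¹ ∉ cs.simple '' X) :
    cs.labelWalk X τ (alternate i j) (M i j) (w, a) =
      cs.labelWalk X τ (alternate j i) (M i j) (w, a) := by
  have move : ∀ u ∈ cs.dihedral i j, ∀ l, l = i ∨ l = j →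
      cs.labelStep X τ l (d * u, a) = (d * (u * cs.simple l), a) := by
    intro u hu l hl
    obtain ⟨q, hq, hq'⟩ := exists_galleryWall_eq h0 hu hl
    rw [labelStep_move, mul_assoc]
    rw [show d * u * cs.simple l * (d * u)⁻¹ = d * (u * cs.simple l * u⁻¹) * d⁻¹ by
      simp [mul_assoc], hq']
    exact hX q hq
  have hmem : ∀ i' j', (i' = i ∨ i' = j) → (j' = i ∨ j' = j) → ∀ n,
      cs.gallery i' j' n ∈ cs.dihedral i j := by
    have hs : ∀ l, (l = i ∨ l = j) → cs.simple l ∈ cs.dihedral i j := by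
      rintro l (rfl | rfl)
      · exact cs.simple_left_mem_dihedral _ _
      · exact cs.simple_right_mem_dihedral _ _
    intro i' j' hi hj n
    induction n with
    | zero => exact one_mem _
    | succ n ih =>
      refine mul_mem ih (hs _ ?_)
      rcases alternate_mem i' j' n with h | h <;> rw [h] <;> assumption
  have key : ∀ i' j', (i' = i ∨ i' = j) → (j' = i ∨ j' = j) →
      cs.labelWalk X τ (alternate i' j') (M i j) (w, a) =
        (w * cs.gallery i' j' (M i j), a) := by
    intro i' j' hi hj
    have := cs.labelWalk_eq_of_step (X := X) (τ := τ) (f := alternate i' j')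
      (F := fun n => (w * cs.gallery i' j' n, a)) (fun n => by
        have hl : alternate i' j' n = i ∨ alternate i' j' n = j := by
          rcases alternate_mem i' j' n with h | h <;> rw [h] <;> assumption
        have := move (d⁻¹ * w * cs.gallery i' j' n) (mul_mem hdw (hmem i' j' hi hj n)) _ hl
        simp only [mul_assoc, mul_inv_cancel_left] at this
        simp only [this]
        rfl) (M i j)
    simpa [gallery] using this
  rw [key i j (Or.inl rfl) (Or.inr rfl), key j i (Or.inr rfl) (Or.inl rfl), gallery_order_eq,
    M.symmetric i j]

/-- Braid relation for walks in a residue whose last wall has simple type in `X`, and whose other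
walls do not. -/
theorem labelWalk_braid_of_last_wall (h0 : M i j ≠ 0) {d w : W} (a : A)
    (hd : cs.IsResidueMin i j d) (hw : cs.IsMinimal X w) (hdw : d⁻¹ * w ∈ cs.dihedral i j)
    (hX : ∀ q, q + 1 < M i j → d * cs.galleryWall i j q * d⁻¹ ∉ cs.simple '' X)
    (hj : d * cs.simple j * d⁻¹ ∈ cs.simple '' X) :
    cs.labelWalk X τ (alternate i j) (M i j) (w, a) =
      cs.labelWalk X τ (alternate j i) (M i j) (w, a) := by
  obtain ⟨k, hk, hdk⟩ := cs.exists_gallery_eq h0 hdw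
  have hlast := cs.galleryWall_last h0
  -- From chamber m on, the simple wall has been crossed, against the minimality of `w`.
  have hkm : k < M i j := by
    by_contra! hmk
    obtain ⟨x, hx, hxd⟩ := hj
    have := hw x hx
    rw [hxd, show w = d * (d⁻¹ * w) by simp, hdk,
      hd.crossing_mul (cs.simple_right_mem_dihedral i j), ← hlast,
      crossing_gallery_galleryWall _ (by omega) (by omega), if_pos (by omega)] at this
    exact one_ne_zero this
  have hwk : w = d * cs.gallery i j k := by rw [← hdk]; simp
  set m := M i j with hm
  set x := d * cs.simple j * d⁻¹
  have wall : ∀ q, d * cs.gallery i j q * cs.simple (alternate i j q) * (d * cs.gallery i j q)⁻¹ =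
      d * cs.galleryWall i j q * d⁻¹ := by
    intro q
    rw [← gallery_conj]
    simp [mul_assoc]
  -- The m chambers on the near side of the wall `x` form a path with both ends on that wall. `F`
  -- runs along it to and fro; each reversal multiplies the label by `τ x`.
  let F : A → ℕ → W × A := fun b n =>
    (d * cs.gallery i j (if Even (n / m) then n % m else m - 1 - n % m), τ x ^ (n / m) * b)
  have hF : ∀ b n, F b (n + 1) = cs.labelStep X τ (alternate i j n) (F b n) := by
    intro b n
    have hmpos : 0 < m := by omega
    have hn := Nat.mod_add_div n m
    have hlt := Nat.mod_lt n hmpos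
    set r := n % m with hr
    set h := n / m with hh
    have hmv : ∀ q, q + 1 < m → ∀ c : A, cs.labelStep X τ (alternate i j q)
        (d * cs.gallery i j q, c) = (d * cs.gallery i j (q + 1), c) := by
      intro q hq c
      rw [labelStep_move, gallery_succ, mul_assoc]
      rw [wall]
      exact hX q hq
    have hmv' : ∀ q, q + 1 < m → ∀ c : A, cs.labelStep X τ (alternate i j q)
        (d * cs.gallery i j (q + 1), c) = (d * cs.gallery i j q, c) := by
      intro q hq c
      rw [labelStep_move, mul_assoc, gallery_mul_simple_pred]
      rw [gallery_succ]
      have := hX q hq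
      rw [← wall] at this
      simpa [mul_assoc] using this
    rcases Nat.lt_or_ge (r + 1) m with hr1 | hr1
    · have hmod : (n + 1) % m = r + 1 := by
        rw [← hn, add_right_comm, Nat.add_mul_mod_self_left, Nat.mod_eq_of_lt hr1]
      have hdiv : (n + 1) / m = h := by
        rw [← hn, add_right_comm, Nat.add_mul_div_left _ _ hmpos, Nat.div_eq_of_lt hr1, zero_add]
      simp only [F, hmod, hdiv, ← hr, ← hh]
      split_ifs with he
      · rw [alternate_congr (l := r), hmv r hr1]
        rw [← hn, add_right_comm, Nat.even_add]
        simp [he]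
      · rw [alternate_congr (l := m - 1 - (r + 1)),
          show m - 1 - r = m - 1 - (r + 1) + 1 by omega, hmv' _ (by omega)]
        rw [← hn, show r + m * h + (m - 1 - (r + 1)) = m * h + (m - 2) by omega]
        rw [Nat.not_even_iff_odd] at he
        obtain ⟨c, hc⟩ := he
        exact ⟨m * c + m - 1, by rw [hc, mul_add, mul_one, ← mul_assoc, mul_comm m 2, mul_assoc];
                                 omega⟩
    · have hr2 : r = m - 1 := by omega
      have hn1 : n + 1 = m * (h + 1) := by rw [mul_add, mul_one]; omega
      have hmod : (n + 1) % m = 0 := by rw [hn1, Nat.mul_mod_right]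
      have hdiv : (n + 1) / m = h + 1 := by rw [hn1, Nat.mul_div_cancel_left _ hmpos]
      simp only [F, hmod, hdiv, ← hr, ← hh, hr2, Nat.even_add_one]
      by_cases he : Even h
      · have e : d * cs.gallery i j (m - 1) * cs.simple (alternate i j (m - 1)) *
            (d * cs.gallery i j (m - 1))⁻¹ = x := by rw [wall, hlast]
        simp only [he, not_true, if_false, if_true, Nat.sub_zero]
        rw [alternate_congr (l := m - 1), labelStep_stay, e, pow_succ', mul_assoc]
        · rw [e]; exact hj
        · rw [← hn, hr2, add_right_comm, Nat.even_add]
          simp [he]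
      · have e : alternate i j n = j := by
          unfold alternate
          rw [if_neg]
          rw [← Nat.even_add_one, hn1, Nat.even_mul, Nat.even_add_one]
          exact Or.inr he
        simp only [he, not_false_eq_true, if_true, if_false, Nat.sub_self]
        rw [e, labelStep_stay]
        · simp [gallery, pow_succ', mul_assoc, x]
        · simpa [gallery] using hj
  have walk : ∀ b t, cs.labelWalk X τ (fun q => alternate i j (t + q)) m (F b t) = F b (t + m) := by
    intro b t
    exact cs.labelWalk_eq_of_step (F := fun n => F b (t + n)) (fun n => hF b (t + n)) m
  -- Both walks from `w` are pieces of this motion: upwards from time k, and downwards from time m +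
  -- (m - 1 - k), where the initial label (τ x)⁻¹ a compensates for the reversal already made. In m
  -- steps each meets one reversal and reaches chamber m - 1 - k with label τ x * a.
  have w1 := walk a k
  have w2 := walk ((τ x)⁻¹ * a) (m + (m - 1 - k))
  have hmpos : 0 < m := by omega
  have f1 : F a k = (w, a) := by
    simp [F, Nat.div_eq_of_lt hkm, Nat.mod_eq_of_lt hkm, hwk]
  have hk' : m - 1 - k < m := by omega
  have f2 : F a (k + m) = (d * cs.gallery i j (m - 1 - k), τ x * a) := by
    simp [F, Nat.div_eq_of_lt hkm, Nat.mod_eq_of_lt hkm, Nat.add_div_right _ hmpos]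
  have f3 : F ((τ x)⁻¹ * a) (m + (m - 1 - k)) = (w, a) := by
    simp only [F, Nat.add_div_left _ hmpos, Nat.add_mod_left, Nat.div_eq_of_lt hk',
      Nat.mod_eq_of_lt hk', hwk]
    simp [show m - 1 - (m - 1 - k) = k by omega]
  have f4 : F ((τ x)⁻¹ * a) (m + (m - 1 - k) + m) =
      (d * cs.gallery i j (m - 1 - k), τ x * a) := by
    simp only [F, Nat.add_div_left _ hmpos, Nat.add_div_right _ hmpos, Nat.add_mod_left,
      Nat.add_mod_right, Nat.div_eq_of_lt hk', Nat.mod_eq_of_lt hk']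
    simp [pow_succ, mul_assoc]
  rw [f1, f2] at w1
  rw [f3, f4] at w2
  have a1 : (fun q => alternate i j (m + (m - 1 - k) + q)) =
      fun q => alternate i j (k + q + 1) := by
    funext q
    apply alternate_congr
    exact ⟨m + q, by omega⟩
  rw [a1] at w2
  simp only [alternate_add_one] at w2
  -- The parity of k decides which of the two directions starts with the letter i.
  rcases Nat.even_or_odd k with hk2 | hk2
  · have e : ∀ i' j' : B, (fun q => alternate i' j' (k + q)) = alternate i' j' := by
      intro i' j'
      funext q
      apply alternate_congr
      rw [show k + q + q = k + 2 * q by ring]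
      exact hk2.add (even_two_mul q)
    rw [e] at w1 w2
    rw [w1, w2]
  · have e : ∀ i' j' : B, (fun q => alternate i' j' (k + q)) = alternate j' i' := by
      intro i' j'
      funext q
      rw [← alternate_add_one]
      apply alternate_congr
      rw [show k + q + 1 + q = k + 1 + 2 * q by ring]
      exact hk2.add_one.add (even_two_mul q)
    rw [e] at w1 w2
    rw [w1, w2]

/-- The last step of a walk is the leftmost factor of the product, so the parity of `n` decides the
leading letter. -/
theorem labelWalk_alternate_eq_altProd {Ω : Type*} (σ : B → Equiv.Perm Ω) (ι : Ω → W × A)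
    (hσ : ∀ l p, ι (σ l p) = cs.labelStep X τ l (ι p)) (n : ℕ) (p : Ω) :
    cs.labelWalk X τ (alternate i j) n (ι p) =
      ι ((if Even n then altProd (σ j) (σ i) n else altProd (σ i) (σ j) n) p) := by
  induction n with
  | zero => simp [labelWalk, altProd]
  | succ n ih =>
    rw [labelWalk, ih, ← hσ]
    by_cases h : Even n <;> simp [h, alternate, Nat.even_add_one, altProd]

/-- Braid relation for walks that start at a chamber where both walls have simple type in `X`. -/
theorem labelWalk_braid_of_both_walls {d : W} (a : A)
    (hi : d * cs.simple i * d⁻¹ ∈ cs.simple '' X) (hj : d * cs.simple j * d⁻¹ ∈ cs.simple '' X)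
    (hτ : altProd (τ (d * cs.simple i * d⁻¹)) (τ (d * cs.simple j * d⁻¹)) (M i j) =
      altProd (τ (d * cs.simple j * d⁻¹)) (τ (d * cs.simple i * d⁻¹)) (M i j)) :
    cs.labelWalk X τ (alternate i j) (M i j) (d, a) =
      cs.labelWalk X τ (alternate j i) (M i j) (d, a) := by
  have key : ∀ i' j', d * cs.simple i' * d⁻¹ ∈ cs.simple '' X →
      d * cs.simple j' * d⁻¹ ∈ cs.simple '' X → ∀ n,
      cs.labelWalk X τ (alternate i' j') n (d, a) =
        (d, (if Even n then altProd (τ (d * cs.simple j' * d⁻¹)) (τ (d * cs.simple i' * d⁻¹)) n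
          else altProd (τ (d * cs.simple i' * d⁻¹)) (τ (d * cs.simple j' * d⁻¹)) n) * a) := by
    intro i' j' hi' hj' n
    induction n with
    | zero => simp [labelWalk, altProd]
    | succ n ih =>
      rw [labelWalk, ih, labelStep_stay]
      · by_cases h : Even n <;> simp [h, alternate, Nat.even_add_one, altProd, mul_assoc]
      · unfold alternate
        split_ifs <;> assumption
  rw [key i j hi hj, key j i hj hi, hτ]

/-- The steps of the set-retraction satisfy the braid relations. -/
theorem labelWalk_braid (hij : i ≠ j) (h0 : M i j ≠ 0) {w : W} (a : A) (hw : cs.IsMinimal X w)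
    (hτ : ∀ x ∈ X, ∀ y ∈ X, x ≠ y → M x y ≠ 0 →
      altProd (τ (cs.simple x)) (τ (cs.simple y)) (M x y) =
        altProd (τ (cs.simple y)) (τ (cs.simple x)) (M x y)) :
    cs.labelWalk X τ (alternate i j) (M i j) (w, a) =
      cs.labelWalk X τ (alternate j i) (M i j) (w, a) := by
  obtain ⟨d, hd, hdw⟩ := cs.exists_isResidueMin i j w
  have h2 := M.two_le_of_ne hij h0
  have hlast := cs.galleryWall_last h0
  have hzero := cs.galleryWall_zero i j
  have hX : ∀ q, 0 < q → q + 1 < M i j → d * cs.galleryWall i j q * d⁻¹ ∉ cs.simple '' X := by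
    rintro q hq hq' ⟨x, hx, hxq⟩
    rcases hd.simple_wall (by omega) hxq with h | h <;> omega
  by_cases hi : d * cs.simple i * d⁻¹ ∈ cs.simple '' X <;>
  by_cases hj : d * cs.simple j * d⁻¹ ∈ cs.simple '' X
  -- Minimality keeps `w` on the near side of both extreme walls, which leaves only the chamber `d`.
  · have hwd : w = d := by
      obtain ⟨k, hk, hdk⟩ := cs.exists_gallery_eq h0 hdw
      have hwk : w = d * cs.gallery i j k := by rw [← hdk]; simp
      obtain ⟨x, hx, hxd⟩ := hi
      obtain ⟨y, hy, hyd⟩ := hj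
      have c1 := hw x hx
      have c2 := hw y hy
      rw [hyd, hwk, hd.crossing_mul (cs.simple_right_mem_dihedral i j), ← hlast,
        crossing_gallery_galleryWall _ (by omega) (by omega)] at c2
      have hkm : k < M i j := by
        by_contra! h
        rw [if_pos (by omega)] at c2
        exact one_ne_zero c2
      rw [hxd, hwk, hd.crossing_mul (cs.simple_left_mem_dihedral i j), ← hzero,
        crossing_gallery_galleryWall _ (by omega) (by omega)] at c1
      have hk0 : k = 0 := by
        by_contra h
        rw [if_pos (by omega)] at c1
        exact one_ne_zero c1
      rw [hwk, hk0, gallery, mul_one]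
    rw [hwd]
    apply labelWalk_braid_of_both_walls a hi hj
    obtain ⟨x, hx, hxd⟩ := hi
    obtain ⟨y, hy, hyd⟩ := hj
    have hM : M x y = M i j := by
      rw [← cs.orderOf_simple_mul_simple, ← cs.orderOf_simple_mul_simple, hxd, hyd,
        ← orderOf_injective (MulAut.conj d).toMonoidHom (MulAut.conj d).injective
          (cs.simple i * cs.simple j)]
      congr 1
      simp
    rw [← hM, ← hxd, ← hyd]
    apply hτ x hx y hy _ (by rwa [hM])
    rintro rfl
    rw [M.diagonal] at hM
    omega
  -- Exchanging i and j reverses the numbering of the walls, so the first wall becomes the last.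
  · have h := labelWalk_braid_of_last_wall (τ := τ) (X := X) (i := j) (j := i)
      (by rwa [M.symmetric j i]) a hd.symm hw (by rwa [dihedral_comm]) ?_ hi
    · rw [M.symmetric j i] at h
      exact h.symm
    · intro q hq
      rw [M.symmetric j i] at hq
      rw [galleryWall_swap _ h0 (by omega)]
      rcases Nat.eq_zero_or_pos q with rfl | hq0
      · rwa [Nat.sub_zero, hlast]
      · exact hX _ (by omega) (by omega)
  · apply labelWalk_braid_of_last_wall h0 a hd hw hdw _ hj
    intro q hq
    rcases Nat.eq_zero_or_pos q with rfl | hq0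
    · rwa [hzero]
    · exact hX _ hq0 hq
  · apply labelWalk_braid_of_no_wall h0 a hdw
    intro q hq
    rcases Nat.eq_zero_or_pos q with rfl | hq0
    · rwa [hzero]
    · by_cases hq' : q = M i j - 1
      · rwa [hq', hlast]
      · exact hX _ hq0 (by omega)

end CoxeterSystem

/-! ### Label steps as permutations. -/

namespace CoxeterSystem

variable {B W : Type*} [Group W] {M : CoxeterMatrix B} (cs : CoxeterSystem M W)

/-- In the geometric representation W_Y changes only coordinates in Y, while s_x maps e_x to -e_x.
-/
theorem mem_of_simple_mem_closure {Y : Set B} {x : B}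
    (hx : cs.simple x ∈ Subgroup.closure (cs.simple '' Y)) : x ∈ Y := by
  by_contra hxY
  let ρ := cs.lift ⟨_, M.isLiftable_geomReflection⟩
  have hρ : ∀ i v, ρ (cs.simple i) v = v - M.geomForm i v • Finsupp.single i 1 := by
    intro i v
    rw [show ρ (cs.simple i) = _ from cs.lift_apply_simple M.isLiftable_geomReflection i]
    rfl
  have key : ∀ w ∈ Subgroup.closure (cs.simple '' Y), ∀ v : B →₀ ℝ, ρ w v x = v x := by
    intro w hw
    induction hw using Subgroup.closure_induction with
    | mem w hw =>
      obtain ⟨y, hy, rfl⟩ := hw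
      intro v
      have : y ≠ x := fun h => hxY (h ▸ hy)
      simp [hρ, this]
    | one => simp
    | mul u w _ _ hu hw =>
      intro v
      rw [map_mul, LinearEquiv.mul_apply, hu, hw]
    | inv w _ hw =>
      intro v
      rw [← hw, ← LinearEquiv.mul_apply, ← map_mul, mul_inv_cancel, map_one]
      rfl
  have := key _ hx (Finsupp.single x 1)
  rw [hρ, M.geomForm_self] at this
  simp at this

section Retraction

variable {A : Type*} [Group A] (X : Set B) (τ : W → A)

open scoped Classical in
/-- A step of the set-retraction as a permutation. -/
noncomputable def labelPerm (i : B) : Equiv.Perm {p : W × A // cs.IsMinimal X p.1} where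
  toFun p := ⟨cs.labelStep X τ i p, p.2.labelStep⟩
  invFun p := ⟨if p.1.1 * cs.simple i * p.1.1⁻¹ ∈ cs.simple '' X then
      (p.1.1, (τ (p.1.1 * cs.simple i * p.1.1⁻¹))⁻¹ * p.1.2) else (p.1.1 * cs.simple i, p.1.2), by
    split_ifs with h
    · exact p.2
    · exact p.2.move h⟩
  left_inv := by
    rintro ⟨⟨u, a⟩, hp⟩
    by_cases h : u * cs.simple i * u⁻¹ ∈ cs.simple '' X
    · simp [labelStep_stay _ h, h]
    · simp only [labelStep_move _ h]
      rw [mul_assoc] at h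
      simp [h]
  right_inv := by
    rintro ⟨⟨u, a⟩, hp⟩
    by_cases h : u * cs.simple i * u⁻¹ ∈ cs.simple '' X
    · simp [labelStep_stay _ h, h]
    · simp only [if_neg h]
      have h' : u * cs.simple i * cs.simple i * (u * cs.simple i)⁻¹ ∉ cs.simple '' X := by
        simpa [mul_assoc] using h
      simp [labelStep_move _ h']

variable {X τ}

theorem labelStep_of_mem {i : B} {p : W × A} (h : p.1 * cs.simple i * p.1⁻¹ ∈ cs.simple '' X) :
    cs.labelStep X τ i p = (p.1, τ (p.1 * cs.simple i * p.1⁻¹) * p.2) := if_pos h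

theorem labelStep_of_notMem {i : B} {p : W × A}
    (h : p.1 * cs.simple i * p.1⁻¹ ∉ cs.simple '' X) :
    cs.labelStep X τ i p = (p.1 * cs.simple i, p.2) := if_neg h

theorem coe_labelPerm (i : B) (p : {p : W × A // cs.IsMinimal X p.1}) :
    (cs.labelPerm X τ i p : W × A) = cs.labelStep X τ i p := rfl

theorem coe_labelPerm_inv_stay {i : B} (p : {p : W × A // cs.IsMinimal X p.1})
    (h : p.1.1 * cs.simple i * p.1.1⁻¹ ∈ cs.simple '' X) :
    ((cs.labelPerm X τ i)⁻¹ p : W × A) =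
      (p.1.1, (τ (p.1.1 * cs.simple i * p.1.1⁻¹))⁻¹ * p.1.2) := if_pos h

theorem coe_labelPerm_inv_move {i : B} (p : {p : W × A // cs.IsMinimal X p.1})
    (h : p.1.1 * cs.simple i * p.1.1⁻¹ ∉ cs.simple '' X) :
    ((cs.labelPerm X τ i)⁻¹ p : W × A) = (p.1.1 * cs.simple i, p.1.2) := if_neg h

open ArtinGroups (altProd) in
theorem labelPerm_braid {i j : B} (hij : i ≠ j) (h0 : M i j ≠ 0)
    (hτ : ∀ x ∈ X, ∀ y ∈ X, x ≠ y → M x y ≠ 0 →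
      altProd (τ (cs.simple x)) (τ (cs.simple y)) (M x y) =
        altProd (τ (cs.simple y)) (τ (cs.simple x)) (M x y)) :
    altProd (cs.labelPerm X τ i) (cs.labelPerm X τ j) (M i j) =
      altProd (cs.labelPerm X τ j) (cs.labelPerm X τ i) (M i j) := by
  refine Equiv.ext fun p => Subtype.ext ?_
  have h := labelWalk_braid hij h0 p.1.2 p.2 hτ
  rw [Prod.mk.eta, labelWalk_alternate_eq_altProd (cs.labelPerm X τ) Subtype.val (fun _ _ => rfl),
    labelWalk_alternate_eq_altProd (cs.labelPerm X τ) Subtype.val (fun _ _ => rfl)] at h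
  split_ifs at h
  · exact h.symm
  · exact h

end Retraction

end CoxeterSystem

/-! ### The retraction to A_X and its consequences for parabolic subgroups. -/

namespace ArtinGroups

theorem map_altProd {G H : Type*} [Group G] [Group H] (f : G →* H) (a b : G) (n : ℕ) :
    f (altProd a b n) = altProd (f a) (f b) n := by
  induction n generalizing a b with
  | zero => simp [altProd]
  | succ n ih => simp [altProd, ih]

variable {V : Type*} {Γ : SimpleGraph V} {m : Γ.edgeSet → ℕ}

local notation "A" => ArtinGroup Γ m

/-- The standard generators of the Artin group. -/
abbrev gen (v : V) : A := PresentedGroup.of v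

theorem gen_braid {v w : V} (h : Γ.Adj v w) :
    altProd (gen v : A) (gen w) (m ⟨s(v, w), h⟩) = altProd (gen w) (gen v) (m ⟨s(v, w), h⟩) := by
  have h1 : (PresentedGroup.mk (artinRels Γ m))
      (altProd (FreeGroup.of v) (FreeGroup.of w) (m ⟨s(v, w), h⟩) *
      (altProd (FreeGroup.of w) (FreeGroup.of v) (m ⟨s(v, w), h⟩))⁻¹) = 1 :=
    PresentedGroup.one_of_mem ⟨v, w, h, rfl⟩
  rw [map_mul, map_inv, mul_inv_eq_one, map_altProd, map_altProd] at h1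
  exact h1

/-- A family of group elements that satisfies the braid relations defines a homomorphism. -/
def artinLift {G : Type*} [Group G] (f : V → G)
    (hf : ∀ v w (h : Γ.Adj v w), altProd (f v) (f w) (m ⟨s(v, w), h⟩) =
      altProd (f w) (f v) (m ⟨s(v, w), h⟩)) : A →* G :=
  PresentedGroup.toGroup (f := f) <| by
    rintro r ⟨v, w, h, rfl⟩
    rw [map_mul, map_inv, mul_inv_eq_one, map_altProd, map_altProd]
    simpa using hf v w h

theorem artinLift_gen {G : Type*} [Group G] (f : V → G)
    (hf : ∀ v w (h : Γ.Adj v w), altProd (f v) (f w) (m ⟨s(v, w), h⟩) =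
      altProd (f w) (f v) (m ⟨s(v, w), h⟩)) (v : V) :
    artinLift f hf (gen v : A) = f v := PresentedGroup.toGroup.of _

open scoped Classical in
/-- The Coxeter matrix of an edge-labelled graph. -/
noncomputable def coxeterMatrix (hm : ∀ e, 2 ≤ m e) : CoxeterMatrix V where
  M v w := if v = w then 1 else if h : Γ.Adj v w then m ⟨s(v, w), h⟩ else 0
  isSymm := by
    apply Matrix.IsSymm.ext
    intro v w
    rcases eq_or_ne v w with rfl | h
    · rfl
    · by_cases h' : Γ.Adj v w
      · simp [h, h.symm, h', h'.symm, Sym2.eq_swap]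
      · have h'' : ¬ Γ.Adj w v := fun h => h' h.symm
        simp [h, h.symm, h', h'']
  diagonal v := by simp
  off_diagonal v w hvw := by
    rw [if_neg hvw]
    split_ifs with h
    · have := hm ⟨s(v, w), h⟩
      omega
    · simp

variable (hm : ∀ e, 2 ≤ m e)

theorem coxeterMatrix_adj {v w : V} (h : Γ.Adj v w) :
    coxeterMatrix hm v w = m ⟨s(v, w), h⟩ := by
  simp [coxeterMatrix, h.ne, h]

theorem adj_iff_coxeterMatrix {v w : V} :
    Γ.Adj v w ↔ v ≠ w ∧ coxeterMatrix hm v w ≠ 0 := by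
  constructor
  · intro h
    refine ⟨h.ne, ?_⟩
    rw [coxeterMatrix_adj hm h]
    have := hm ⟨s(v, w), h⟩
    omega
  · rintro ⟨h1, h2⟩
    by_contra h
    exact h2 (by simp [coxeterMatrix, h1, h])

/-- The Coxeter system of an edge-labelled graph. -/
noncomputable abbrev coxeterSystem : CoxeterSystem (coxeterMatrix hm) (coxeterMatrix hm).Group :=
  (coxeterMatrix hm).toCoxeterSystem

open scoped Classical in
/-- The Artin generator over a simple reflection. -/
noncomputable def liftSimple (w : (coxeterMatrix hm).Group) : A :=
  if h : ∃ v, (coxeterSystem hm).simple v = w then gen h.choose else 1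

theorem liftSimple_simple (v : V) : liftSimple hm ((coxeterSystem hm).simple v) = gen v := by
  have h : ∃ v', (coxeterSystem hm).simple v' = (coxeterSystem hm).simple v := ⟨v, rfl⟩
  rw [liftSimple, dif_pos h, (coxeterSystem hm).simple_injective h.choose_spec]

/-- The set on which the Artin group acts to define the retraction to `A_X`. -/
abbrev RetractionSet (X : Set V) : Type _ :=
  {p : (coxeterMatrix hm).Group × A // (coxeterSystem hm).IsMinimal X p.1}

/-- The action of the Artin group that defines the retraction to `A_X`. -/
noncomputable def retractionAction (X : Set V) : A →* Equiv.Perm (RetractionSet hm X) :=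
  artinLift ((coxeterSystem hm).labelPerm X (liftSimple hm)) <| by
    intro v w h
    rw [← coxeterMatrix_adj hm h]
    obtain ⟨h1, h2⟩ := (adj_iff_coxeterMatrix hm).mp h
    apply CoxeterSystem.labelPerm_braid _ h1 h2
    intro x _ y _ hxy h0
    have hadj : Γ.Adj x y := (adj_iff_coxeterMatrix hm).mpr ⟨hxy, h0⟩
    rw [liftSimple_simple, liftSimple_simple, coxeterMatrix_adj hm hadj, gen_braid]

theorem retractionAction_gen (X : Set V) (v : V) :
    retractionAction hm X (gen v) = (coxeterSystem hm).labelPerm X (liftSimple hm) v :=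
  artinLift_gen _ _ v

variable {hm} {X Y Z : Set V}

theorem gen_mem {v : V} (hv : v ∈ X) : (gen v : A) ∈ standardParabolic Γ m X :=
  Subgroup.subset_closure ⟨v, hv, rfl⟩

theorem standardParabolic_mono (h : X ⊆ Y) : standardParabolic Γ m X ≤ standardParabolic Γ m Y :=
  Subgroup.closure_mono (Set.image_mono h)

theorem standardParabolic_univ : standardParabolic Γ m Set.univ = ⊤ := by
  rw [standardParabolic, Set.image_univ]
  exact PresentedGroup.closure_range_of _

/-- The base point of the retraction set, shifted by an element of the Artin group. -/
noncomputable def RetractionSet.base (X : Set V) (a : A) : RetractionSet hm X :=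
  ⟨(1, a), fun _ _ => (coxeterSystem hm).crossing_one _⟩

variable (hm)

/-- At the chamber 1 every letter of X faces a simple wall of type X, so the walk never moves and
only records its letters. -/
theorem retractionAction_base {h : A} (hh : h ∈ standardParabolic Γ m X) (a : A) :
    retractionAction hm X h (.base X a) = .base X (h * a) := by
  induction hh using Subgroup.closure_induction generalizing a with
  | mem h hh =>
    obtain ⟨x, hx, rfl⟩ := hh
    rw [retractionAction_gen]
    apply Subtype.ext
    rw [CoxeterSystem.coe_labelPerm]
    refine ((coxeterSystem hm).labelStep_stay ?_).trans ?_
    · exact ⟨x, hx, by simp⟩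
    · simp only [one_mul, inv_one, mul_one, RetractionSet.base]
      exact congrArg (fun b => ((1 : (coxeterMatrix hm).Group), b * a)) (liftSimple_simple hm x)
  | one => simp
  | mul g h _ _ hg hh => rw [map_mul, Equiv.Perm.mul_apply, hh, hg, mul_assoc]
  | inv h _ hh =>
    rw [map_inv, Equiv.Perm.inv_eq_iff_eq, hh, mul_inv_cancel_left]

/-- Letters of Y keep the chamber in W_Y, so a recorded wall is a simple reflection in W_Y, and its
type lies in X ∩ Y. -/
theorem retractionAction_mem {g : A} (hg : g ∈ standardParabolic Γ m Y)
    (p : RetractionSet hm X)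
    (hp : p.1.1 ∈ Subgroup.closure ((coxeterSystem hm).simple '' Y)) :
    (retractionAction hm X g p).1.1 ∈ Subgroup.closure ((coxeterSystem hm).simple '' Y) ∧
      ∃ b ∈ standardParabolic Γ m (X ∩ Y), (retractionAction hm X g p).1.2 = b * p.1.2 := by
  have wall : ∀ y ∈ Y, ∀ q : RetractionSet hm X,
      q.1.1 ∈ Subgroup.closure ((coxeterSystem hm).simple '' Y) →
      q.1.1 * (coxeterSystem hm).simple y * q.1.1⁻¹ ∈ (coxeterSystem hm).simple '' X →
      liftSimple hm (q.1.1 * (coxeterSystem hm).simple y * q.1.1⁻¹) ∈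
        standardParabolic Γ m (X ∩ Y) := by
    rintro y hy q hq ⟨x, hx, hxq⟩
    have hmem : q.1.1 * (coxeterSystem hm).simple y * q.1.1⁻¹ ∈
        Subgroup.closure ((coxeterSystem hm).simple '' Y) :=
      mul_mem (mul_mem hq (Subgroup.subset_closure ⟨y, hy, rfl⟩)) (inv_mem hq)
    rw [← hxq] at hmem ⊢
    rw [liftSimple_simple]
    exact gen_mem ⟨hx, (coxeterSystem hm).mem_of_simple_mem_closure hmem⟩
  have hs : ∀ y ∈ Y, (coxeterSystem hm).simple y ∈
      Subgroup.closure ((coxeterSystem hm).simple '' Y) :=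
    fun y hy => Subgroup.subset_closure ⟨y, hy, rfl⟩
  induction hg using Subgroup.closure_induction_left with
  | one => exact ⟨hp, 1, one_mem _, by simp⟩
  | mul_left x hx g _ ih =>
    obtain ⟨y, hy, rfl⟩ := hx
    obtain ⟨h1, b, hb, h2⟩ := ih
    rw [map_mul, Equiv.Perm.mul_apply, retractionAction_gen, CoxeterSystem.coe_labelPerm]
    set q := retractionAction hm X g p
    by_cases h : q.1.1 * (coxeterSystem hm).simple y * q.1.1⁻¹ ∈ (coxeterSystem hm).simple '' X
    · rw [CoxeterSystem.labelStep_of_mem _ h]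
      exact ⟨h1, _, mul_mem (wall y hy q h1 h) hb, by rw [h2]; exact (mul_assoc _ _ _).symm⟩
    · rw [CoxeterSystem.labelStep_of_notMem _ h]
      exact ⟨mul_mem h1 (hs y hy), b, hb, h2⟩
  | inv_mul_cancel x hx g _ ih =>
    obtain ⟨y, hy, rfl⟩ := hx
    obtain ⟨h1, b, hb, h2⟩ := ih
    rw [map_mul, map_inv, Equiv.Perm.mul_apply, retractionAction_gen]
    set q := retractionAction hm X g p
    by_cases h : q.1.1 * (coxeterSystem hm).simple y * q.1.1⁻¹ ∈ (coxeterSystem hm).simple '' X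
    · rw [CoxeterSystem.coe_labelPerm_inv_stay _ _ h]
      exact ⟨h1, _, mul_mem (inv_mem (wall y hy q h1 h)) hb, by
        rw [h2]; exact (mul_assoc _ _ _).symm⟩
    · rw [CoxeterSystem.coe_labelPerm_inv_move _ _ h]
      exact ⟨mul_mem h1 (hs y hy), b, hb, h2⟩

/-- Van der Lek's theorem on intersections of standard parabolic subgroups. -/
theorem standardParabolic_inf (hm : ∀ e, 2 ≤ m e) (X Y : Set V) :
    standardParabolic Γ m X ⊓ standardParabolic Γ m Y = standardParabolic Γ m (X ∩ Y) := by
  apply le_antisymm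
  · rintro g ⟨hgX, hgY⟩
    -- The label reached from the base point is `g` because g ∈ A_X, and lies in A_{X∩Y} because g ∈
    -- A_Y.
    obtain ⟨-, b, hb, h⟩ := retractionAction_mem hm (X := X) hgY (.base X 1) (one_mem _)
    rw [retractionAction_base hm hgX] at h
    simp only [RetractionSet.base, mul_one] at h
    rwa [h]
  · exact le_inf (standardParabolic_mono Set.inter_subset_left)
      (standardParabolic_mono Set.inter_subset_right)

/-- Labels are recorded on the left, so the action commutes with right multiplication of labels. -/
theorem retractionAction_mul_right (g a b : A) (u u' : (coxeterMatrix hm).Group) (a' : A)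
    (hu : (coxeterSystem hm).IsMinimal X u) (hu' : (coxeterSystem hm).IsMinimal X u')
    (h : retractionAction hm X g ⟨(u, a), hu⟩ = ⟨(u', a'), hu'⟩) :
    retractionAction hm X g ⟨(u, a * b), hu⟩ = ⟨(u', a' * b), hu'⟩ := by
  let r : RetractionSet hm X → RetractionSet hm X := fun p => ⟨(p.1.1, p.1.2 * b), p.2⟩
  suffices ∀ p, retractionAction hm X g (r p) = r (retractionAction hm X g p) by
    have := this ⟨(u, a), hu⟩
    rw [h] at this
    exact this
  have hg : g ∈ standardParabolic Γ m Set.univ := by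
    rw [standardParabolic_univ]
    trivial
  clear h
  induction hg using Subgroup.closure_induction with
  | mem g hg =>
    obtain ⟨v, -, rfl⟩ := hg
    rintro ⟨⟨u, a⟩, hp⟩
    rw [retractionAction_gen]
    apply Subtype.ext
    simp only [r, CoxeterSystem.coe_labelPerm]
    by_cases h : u * (coxeterSystem hm).simple v * u⁻¹ ∈ (coxeterSystem hm).simple '' X
    · rw [CoxeterSystem.labelStep_stay _ h, CoxeterSystem.labelStep_stay _ h, ← mul_assoc]
    · rw [CoxeterSystem.labelStep_move _ h, CoxeterSystem.labelStep_move _ h]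
  | one => simp
  | mul g h _ _ hg hh =>
    intro p
    rw [map_mul, Equiv.Perm.mul_apply, Equiv.Perm.mul_apply, hh, hg]
  | inv g _ hg =>
    intro p
    rw [map_inv, Equiv.Perm.inv_eq_iff_eq, hg, ← Equiv.Perm.mul_apply, mul_inv_cancel]
    rfl

/-- Write b = k z k⁻¹, so z k⁻¹ = k⁻¹ b, and let both sides act on the base point. The right side
ends at the chamber of k⁻¹ with label b. Hence the last letter z on the left did not move, and the
generator that it recorded is b. -/
theorem conj_gen_of_retraction {k : A}
    (hk : (retractionAction hm Y k⁻¹ (.base Y 1)).1.2 = 1) {z : V}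
    (hz : k * gen z * k⁻¹ ∈ standardParabolic Γ m Y) :
    ∃ y ∈ Y, (retractionAction hm Y k⁻¹ (.base Y 1)).1.1 * (coxeterSystem hm).simple z *
        (retractionAction hm Y k⁻¹ (.base Y 1)).1.1⁻¹ = (coxeterSystem hm).simple y ∧
      k * gen z * k⁻¹ = gen y := by
  set b := k * gen z * k⁻¹ with hb
  have hcomm : gen z * k⁻¹ = k⁻¹ * b := by rw [hb]; group
  set p := retractionAction hm Y k⁻¹ (.base Y 1) with hp
  have e1 : retractionAction hm Y (gen z * k⁻¹) (.base Y 1) =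
      (coxeterSystem hm).labelPerm Y (liftSimple hm) z p := by
    rw [map_mul, Equiv.Perm.mul_apply, retractionAction_gen]
  have e2 : retractionAction hm Y (k⁻¹ * b) (.base Y 1) = ⟨(p.1.1, p.1.2 * b), p.2⟩ := by
    rw [map_mul, Equiv.Perm.mul_apply, retractionAction_base hm hz, mul_one]
    have := retractionAction_mul_right hm (X := Y) k⁻¹ 1 b 1 p.1.1 p.1.2
      (fun _ _ => (coxeterSystem hm).crossing_one _) p.2 hp.symm
    rw [one_mul] at this
    exact this
  have e3 := congrArg Subtype.val (e1.symm.trans ((congrArg (fun g =>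
    retractionAction hm Y g (.base Y 1)) hcomm).trans e2))
  rw [CoxeterSystem.coe_labelPerm, hk, one_mul] at e3
  by_cases h : p.1.1 * (coxeterSystem hm).simple z * p.1.1⁻¹ ∈ (coxeterSystem hm).simple '' Y
  · rw [CoxeterSystem.labelStep_of_mem _ h, hk, mul_one] at e3
    obtain ⟨y, hy, hyp⟩ := h
    refine ⟨y, hy, hyp.symm, ?_⟩
    rw [← hyp, liftSimple_simple] at e3
    exact (congrArg Prod.snd e3).symm
  · rw [CoxeterSystem.labelStep_of_notMem _ h] at e3
    have := congrArg Prod.fst e3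
    exfalso
    have h1 : (coxeterSystem hm).simple z = 1 := by simpa using this
    have h2 := (coxeterSystem hm).length_simple z
    rw [h1, CoxeterSystem.length_one] at h2
    exact zero_ne_one h2

theorem mem_conjParabolic {g x : A} :
    x ∈ conjParabolic Γ m g X ↔ g⁻¹ * x * g ∈ standardParabolic Γ m X := by
  rw [conjParabolic, Subgroup.mem_map]
  constructor
  · rintro ⟨y, hy, rfl⟩
    simpa [mul_assoc] using hy
  · intro h
    exact ⟨_, h, by simp [mul_assoc]⟩

theorem conjParabolic_one : conjParabolic Γ m 1 X = standardParabolic Γ m X := by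
  ext x
  simp [mem_conjParabolic]

theorem conjParabolic_eq_map_mul (g h : A) :
    (conjParabolic Γ m h X).map (MulAut.conj g).toMonoidHom = conjParabolic Γ m (g * h) X := by
  rw [conjParabolic, conjParabolic, Subgroup.map_map]
  congr 1
  ext x
  simp

theorem conjParabolic_mul_mem (g : A) {h : A} (hh : h ∈ standardParabolic Γ m X) :
    conjParabolic Γ m (g * h) X = conjParabolic Γ m g X := by
  ext x
  rw [mem_conjParabolic, mem_conjParabolic, mul_inv_rev]
  rw [show h⁻¹ * g⁻¹ * x * (g * h) = h⁻¹ * (g⁻¹ * x * g) * h by group,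
    Subgroup.mul_mem_cancel_right _ hh, Subgroup.mul_mem_cancel_left _ (inv_mem hh)]

theorem conjParabolic_le {g : A} (hXY : X ⊆ Y) (hg : g ∈ standardParabolic Γ m Y) :
    conjParabolic Γ m g X ≤ standardParabolic Γ m Y := by
  intro x hx
  rw [mem_conjParabolic] at hx
  have := standardParabolic_mono hXY hx
  rwa [Subgroup.mul_mem_cancel_right _ hg, Subgroup.mul_mem_cancel_left _ (inv_mem hg)] at this

/-- A parabolic subgroup contained in `A_Y` is a parabolic subgroup of `A_Y`. -/
theorem exists_eq_conjParabolic_of_le (hm : ∀ e, 2 ≤ m e) {g : A}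
    (hle : conjParabolic Γ m g Z ≤ standardParabolic Γ m Y) :
    ∃ Y' ⊆ Y, ∃ h ∈ standardParabolic Γ m Y, conjParabolic Γ m g Z = conjParabolic Γ m h Y' ∧
      (FreeOfInfinity Γ Z ↔ FreeOfInfinity Γ Y') := by
  set h := (retractionAction hm Y g⁻¹ (.base Y 1)).1.2 with hh
  have hhY : h ∈ standardParabolic Γ m Y := by
    obtain ⟨-, b, hb, h'⟩ := retractionAction_mem hm (X := Y) (Y := Set.univ) (g := g⁻¹)
      (by rw [standardParabolic_univ]; trivial) (.base Y 1) (one_mem _)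
    rw [Set.inter_univ] at hb
    rw [hh, h']
    simpa [RetractionSet.base] using hb
  -- Here `h` ∈ A_Y is the retraction of g⁻¹; the correction makes the retraction of k⁻¹ trivial.
  set k := h * g with hkdef
  have hk : (retractionAction hm Y k⁻¹ (.base Y 1)).1.2 = 1 := by
    rw [hkdef, mul_inv_rev, map_mul, Equiv.Perm.mul_apply, retractionAction_base hm (inv_mem hhY),
      mul_one]
    set p := retractionAction hm Y g⁻¹ (.base Y 1) with hp
    have := retractionAction_mul_right hm (X := Y) g⁻¹ 1 h⁻¹ 1 p.1.1 p.1.2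
      (fun _ _ => (coxeterSystem hm).crossing_one _) p.2 hp.symm
    rw [one_mul] at this
    rw [show (RetractionSet.base Y h⁻¹ : RetractionSet hm Y) = ⟨(1, h⁻¹), _⟩ from rfl, this]
    exact mul_inv_cancel h
  set u := (retractionAction hm Y k⁻¹ (.base Y 1)).1.1 with hu
  have key : ∀ z ∈ Z, ∃ y ∈ Y, u * (coxeterSystem hm).simple z * u⁻¹ =
      (coxeterSystem hm).simple y ∧ k * gen z * k⁻¹ = gen y := by
    intro z hz
    apply conj_gen_of_retraction hm hk
    have : g * gen z * g⁻¹ ∈ standardParabolic Γ m Y := by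
      apply hle
      rw [mem_conjParabolic]
      simpa [mul_assoc] using gen_mem hz
    rw [hkdef, show h * g * gen z * (h * g)⁻¹ = h * (g * gen z * g⁻¹) * h⁻¹ by group]
    exact mul_mem (mul_mem hhY this) (inv_mem hhY)
  choose! f hfY hfu hfk using key
  -- Conjugation by `u` preserves orders of products in the Coxeter group, so `f` preserves labels
  -- and hence adjacency.
  have hM : ∀ z ∈ Z, ∀ z' ∈ Z, coxeterMatrix hm (f z) (f z') = coxeterMatrix hm z z' := by
    intro z hz z' hz'
    rw [← (coxeterSystem hm).orderOf_simple_mul_simple,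
      ← (coxeterSystem hm).orderOf_simple_mul_simple, ← hfu z hz, ← hfu z' hz',
      ← orderOf_injective (MulAut.conj u).toMonoidHom (MulAut.conj u).injective
        ((coxeterSystem hm).simple z * (coxeterSystem hm).simple z')]
    congr 1
    simp
  have hinj : ∀ z ∈ Z, ∀ z' ∈ Z, (f z = f z' ↔ z = z') := by
    intro z hz z' hz'
    constructor
    · intro h
      apply (coxeterSystem hm).simple_injective
      have := (hfu z hz).trans (h ▸ (hfu z' hz').symm)
      simpa using this
    · rintro rfl
      rfl
  have hadj : ∀ z ∈ Z, ∀ z' ∈ Z, (Γ.Adj (f z) (f z') ↔ Γ.Adj z z') := by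
    intro z hz z' hz'
    rw [adj_iff_coxeterMatrix hm, adj_iff_coxeterMatrix hm, hM z hz z' hz', Ne, hinj z hz z' hz']
  refine ⟨f '' Z, ?_, h⁻¹, inv_mem hhY, ?_, ?_⟩
  · rintro _ ⟨z, hz, rfl⟩
    exact hfY z hz
  · have : conjParabolic Γ m k Z = standardParabolic Γ m (f '' Z) := by
      rw [conjParabolic, standardParabolic, standardParabolic, MonoidHom.map_closure,
        Set.image_image, Set.image_image]
      congr 1
      apply Set.image_congr
      intro z hz
      exact hfk z hz
    rw [conjParabolic.eq_1 _ _ h⁻¹, ← this, conjParabolic_eq_map_mul, hkdef, inv_mul_cancel_left]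
  · constructor
    · rintro hZ _ ⟨z, hz, rfl⟩ _ ⟨z', hz', rfl⟩ hne
      exact (hadj z hz z' hz').mpr (hZ z hz z' hz' fun h => hne (h ▸ rfl))
    · intro hZ z hz z' hz' hne
      exact (hadj z hz z' hz').mp (hZ _ ⟨z, hz, rfl⟩ _ ⟨z', hz', rfl⟩
        fun h => hne ((hinj z hz z' hz').mp h))

theorem FreeOfInfinity.of_conjParabolic_le (hm : ∀ e, 2 ≤ m e) {g h : A} (hY : FreeOfInfinity Γ Y)
    (hle : conjParabolic Γ m g Z ≤ conjParabolic Γ m h Y) : FreeOfInfinity Γ Z := by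
  have hle' : conjParabolic Γ m (h⁻¹ * g) Z ≤ standardParabolic Γ m Y := by
    rw [← conjParabolic_eq_map_mul]
    refine (Subgroup.map_mono hle).trans ?_
    rw [conjParabolic_eq_map_mul, inv_mul_cancel, conjParabolic_one]
  obtain ⟨Y', hY', -, -, -, hfree⟩ := exists_eq_conjParabolic_of_le hm hle'
  exact hfree.mpr fun v hv w hw => hY v (hY' hv) w (hY' hw)

end ArtinGroups

/-! ### Alternating words and the amalgam over two nonadjacent vertices. -/

namespace ArtinGroups

section AlternatingWords

variable {G : Type*} [Group G] {S : Bool → Subgroup G} {K : Subgroup G}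

/-- The letters of the list lie alternately in the two subgroups `S b` and `S !b`, starting with
`S b`, and none of them lies in `K`. -/
def IsAlternating (S : Bool → Subgroup G) (K : Subgroup G) : Bool → List G → Prop
  | _, [] => True
  | b, g :: l => g ∈ S b ∧ g ∉ K ∧ IsAlternating S K (!b) l

theorem IsAlternating.mono {S' : Bool → Subgroup G} {K' : Subgroup G} (hS : ∀ b, S b ≤ S' b)
    (hK : ∀ b, S b ⊓ K' ≤ K) {b : Bool} {l : List G} (hl : IsAlternating S K b l) :
    IsAlternating S' K' b l := by
  induction l generalizing b with
  | nil => trivial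
  | cons g l ih => exact ⟨hS b hl.1, fun h => hl.2.1 (hK b ⟨hl.1, h⟩), ih hl.2.2⟩

/-- The letters of `l` are inverted and moved to the front of `l'` one by one; nothing merges, since
the two words start in different subgroups. -/
theorem IsAlternating.exists_inv_mul {b : Bool} {l l' : List G} (hl : IsAlternating S K b l)
    (hl' : IsAlternating S K (!b) l') :
    ∃ b' l'', IsAlternating S K b' l'' ∧ l''.prod = l.prod⁻¹ * l'.prod ∧
      l''.length = l.length + l'.length := by
  induction l generalizing b l' with
  | nil => exact ⟨!b, l', hl', by simp, by simp⟩
  | cons g l ih =>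
    obtain ⟨b', l'', h1, h2, h3⟩ := ih (l' := g⁻¹ :: l') hl.2.2
      ⟨by simpa using hl.1, by simpa using hl.2.1, by simpa using hl'⟩
    refine ⟨b', l'', h1, ?_, ?_⟩
    · rw [h2]
      simp [mul_assoc]
    · rw [h3]
      simp only [List.length_cons]
      omega

theorem IsAlternating.append {b : Bool} {l : List G} {e : G}
    (h : IsAlternating S K b (l ++ [e])) :
    ∃ c, e ∈ S c ∧ e ∉ K ∧ ∀ l', IsAlternating S K c l' → IsAlternating S K b (l ++ l') := by
  induction l generalizing b with
  | nil => exact ⟨b, h.1, h.2.1, fun l' h' => h'⟩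
  | cons g l ih =>
    obtain ⟨c, h1, h2, h3⟩ := ih h.2.2
    exact ⟨c, h1, h2, fun l' h' => ⟨h.1, h.2.1, h3 l' h'⟩⟩

open scoped Pointwise

/-- The union of two subgroups, whose powers measure syllable lengths. -/
def syllables (S : Bool → Subgroup G) : Set G := ↑(S true) ∪ ↑(S false)

theorem mem_syllables {g : G} : g ∈ syllables S ↔ ∃ b, g ∈ S b := by
  simp [syllables, or_comm]

theorem IsAlternating.prod_mem {b : Bool} {l : List G} (h : IsAlternating S K b l) :
    l.prod ∈ syllables S ^ l.length := by
  induction l generalizing b with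
  | nil => simp
  | cons g l ih =>
    rw [List.prod_cons, List.length_cons, pow_succ']
    exact Set.mul_mem_mul (mem_syllables.mpr ⟨b, h.1⟩) (ih h.2.2)

theorem mul_mem_syllables_pow (hK : ∀ b, K ≤ S b) {n : ℕ} {g k : G}
    (hg : g ∈ syllables S ^ (n + 1)) (hk : k ∈ K) : g * k ∈ syllables S ^ (n + 1) := by
  rw [pow_succ, Set.mem_mul] at hg ⊢
  obtain ⟨x, hx, y, hy, rfl⟩ := hg
  obtain ⟨b, hb⟩ := mem_syllables.mp hy
  exact ⟨x, hx, y * k, mem_syllables.mpr ⟨b, mul_mem hb (hK b hk)⟩, by rw [mul_assoc]⟩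

/-- Prepend syllables one at a time. A syllable that merges with the head, or a product in K that
the next letter absorbs, never lengthens the word. -/
theorem exists_isAlternating_of_mem_pow (hK : ∀ b, K ≤ S b) {n : ℕ} {g : G}
    (hg : g ∈ syllables S ^ n) :
    g ∈ K ∨ ∃ b l, IsAlternating S K b l ∧ l ≠ [] ∧ l.length ≤ n ∧ l.prod = g := by
  induction n generalizing g with
  | zero =>
    rw [pow_zero, Set.mem_one] at hg
    exact Or.inl (hg ▸ one_mem K)
  | succ n ih =>
    rw [pow_succ', Set.mem_mul] at hg
    obtain ⟨s, hs, x, hx, rfl⟩ := hg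
    obtain ⟨c, hc⟩ := mem_syllables.mp hs
    rcases ih hx with hxK | ⟨b, l, hl, hne, hlen, rfl⟩
    · by_cases h : s * x ∈ K
      · exact Or.inl h
      · exact Or.inr ⟨c, [s * x], ⟨mul_mem hc (hK c hxK), h, trivial⟩, by simp, by simp, by simp⟩
    · obtain ⟨y, t, rfl⟩ := List.exists_cons_of_ne_nil hne
      rw [List.length_cons] at hlen
      by_cases hsb : s ∈ S b
      · by_cases h : s * y ∈ K
        · cases t with
          | nil => exact Or.inl (by simpa using h)
          | cons z t =>
            refine Or.inr ⟨!b, (s * y * z) :: t, ⟨mul_mem (hK _ h) hl.2.2.1, ?_, hl.2.2.2.2⟩,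
              by simp, by simp at hlen ⊢; omega, by simp [mul_assoc]⟩
            rw [Subgroup.mul_mem_cancel_left _ h]
            exact hl.2.2.2.1
        · exact Or.inr ⟨b, (s * y) :: t, ⟨mul_mem hsb hl.1, h, hl.2.2⟩, by simp,
            by simp; omega, by simp [mul_assoc]⟩
      · have hcb : c = !b := by
          cases c <;> cases b <;> first | rfl | exact absurd hc hsb
        refine Or.inr ⟨c, s :: y :: t, ⟨hc, fun h => hsb (hK b h), ?_⟩, by simp,
          by simp; omega, by simp⟩
        rw [hcb, Bool.not_not]
        exact hl

end AlternatingWords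

open Monoid

variable {V : Type*} {Γ : SimpleGraph V} {m : Γ.edgeSet → ℕ}

local notation "A" => ArtinGroup Γ m

/-- One of two vertices, indexed by a Boolean. -/
abbrev pick (v w : V) (b : Bool) : V := if b then v else w

variable (Γ m) in
/-- The standard parabolic subgroup that omits one of two vertices from `Z`. -/
abbrev omitOne (v w : V) (Z : Set V) (b : Bool) : Subgroup A :=
  standardParabolic Γ m (Z \ {pick v w b})

variable (Γ m) in
/-- The standard parabolic subgroup that omits both vertices from `Z`. -/
abbrev omitBoth (v w : V) (Z : Set V) : Subgroup A := standardParabolic Γ m (Z \ {v, w})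

theorem omitBoth_le (v w : V) (Z : Set V) (b : Bool) :
    omitBoth Γ m v w Z ≤ omitOne Γ m v w Z b := by
  apply standardParabolic_mono
  apply Set.sdiff_subset_sdiff_right
  cases b <;> simp [pick]

/-- The inclusions of the amalgamated subgroup into the two factors. -/
abbrev amalgamInclusion (v w : V) (b : Bool) :
    omitBoth Γ m v w Set.univ →* omitOne Γ m v w Set.univ b :=
  Subgroup.inclusion (omitBoth_le v w Set.univ b)

variable {v w : V}

theorem exists_mem_omit (hvw : v ≠ w) (u : V) : ∃ b, u ≠ pick v w b := by
  by_cases h : u = v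
  · exact ⟨false, by simpa [pick, h] using hvw⟩
  · exact ⟨true, by simpa [pick] using h⟩

theorem gen_mem_omitOne {u : V} {b : Bool} (h : u ≠ pick v w b) :
    (gen u : A) ∈ omitOne Γ m v w Set.univ b :=
  gen_mem ⟨trivial, h⟩

/-- If `v` and `w` are not adjacent then the Artin group maps to the amalgamated product. -/
theorem exists_hom_amalgam (hvw : v ≠ w) (hadj : ¬ Γ.Adj v w) :
    ∃ Φ : A →* PushoutI (amalgamInclusion (Γ := Γ) (m := m) v w),
      ∀ (b : Bool) (g : omitOne Γ m v w Set.univ b), Φ g = PushoutI.of b g := by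
  choose β hβ using exists_mem_omit hvw
  let f : V → PushoutI (amalgamInclusion (Γ := Γ) (m := m) v w) :=
    fun u => PushoutI.of (β u) ⟨gen u, gen_mem_omitOne (hβ u)⟩
  -- A vertex other than `v` and `w` lies in both factors, and its two images agree in the
  -- amalgamated subgroup.
  have hf : ∀ u b (h : u ≠ pick v w b), f u = PushoutI.of b ⟨gen u, gen_mem_omitOne h⟩ := by
    intro u b h
    by_cases hb : β u = b
    · subst hb
      rfl
    · have hu : u ∉ ({v, w} : Set V) := by
        have := hβ u
        revert this h hb
        cases b <;> cases β u <;> simp [pick] <;> tauto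
      let k : omitBoth Γ m v w Set.univ := ⟨gen u, gen_mem ⟨trivial, hu⟩⟩
      exact (PushoutI.of_apply_eq_base (amalgamInclusion v w) (β u) k).trans
        (PushoutI.of_apply_eq_base (amalgamInclusion v w) b k).symm
  have hrel : ∀ u u' (h : Γ.Adj u u'), altProd (f u) (f u') (m ⟨s(u, u'), h⟩) =
      altProd (f u') (f u) (m ⟨s(u, u'), h⟩) := by
    intro u u' h
    -- Adjacent vertices are not `v` and `w` together, so each relation lives in one factor.
    obtain ⟨b, hb, hb'⟩ : ∃ b, u ≠ pick v w b ∧ u' ≠ pick v w b := by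
      by_contra! hcon
      have h1 := hcon true
      have h2 := hcon false
      simp only [pick, if_true, Bool.false_eq_true, if_false] at h1 h2
      by_cases huv : u = v
      · subst huv
        have := h2 hvw
        subst this
        exact hadj h
      · have := h1 huv
        subst this
        by_cases huw : u = w
        · subst huw
          exact hadj h.symm
        · exact hvw (h2 huw)
    rw [hf u b hb, hf u' b hb', ← map_altProd, ← map_altProd]
    congr 1
    apply Subtype.ext
    have h1 := map_altProd (omitOne Γ m v w Set.univ b).subtype
    simp only [Subgroup.subtype_apply] at h1
    rw [h1, h1]
    exact gen_braid h
  refine ⟨artinLift f hrel, fun b ⟨g, hg⟩ => ?_⟩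
  induction hg using Subgroup.closure_induction with
  | mem x hx =>
    obtain ⟨u, hu, rfl⟩ := hx
    exact (artinLift_gen f hrel u).trans (hf u b (by simpa using hu.2))
  | one => exact (map_one _).trans (map_one _).symm
  | mul x y hx hy ihx ihy =>
    have := congrArg₂ (· * ·) ihx ihy
    simp only [← map_mul] at this
    exact this
  | inv x hx ihx =>
    have := congrArg (·⁻¹) ihx
    simp only [← map_inv] at this
    exact this

/-- In the amalgamated product, a nontrivial alternating product is not in the amalgamated
subgroup. -/
theorem IsAlternating.prod_notMem (hvw : v ≠ w) (hadj : ¬ Γ.Adj v w) {b : Bool} {l : List A}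
    (hl : IsAlternating (omitOne Γ m v w Set.univ) (omitBoth Γ m v w Set.univ) b l) (hne : l ≠ []) :
    l.prod ∉ omitBoth Γ m v w Set.univ := by
  classical
  obtain ⟨Φ, hΦ⟩ := exists_hom_amalgam (m := m) hvw hadj
  have key : ∀ (l : List A) b,
      IsAlternating (omitOne Γ m v w Set.univ) (omitBoth Γ m v w Set.univ) b l →
      ∃ x : CoprodI.Word fun b => omitOne Γ m v w Set.univ b,
        PushoutI.Reduced (amalgamInclusion (Γ := Γ) (m := m) v w) x ∧
        PushoutI.ofCoprodI x.prod = Φ l.prod ∧ x.fstIdx ≠ some (!b) ∧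
        (l ≠ [] → x ≠ CoprodI.Word.empty) := by
    intro l
    induction l with
    | nil =>
      intro b _
      exact ⟨CoprodI.Word.empty, fun g hg => by simp [CoprodI.Word.empty] at hg, by simp,
        by simp [CoprodI.Word.fstIdx, CoprodI.Word.empty], by simp⟩
    | cons g t ih =>
      intro b hl
      obtain ⟨y, hy, hprod, hfst, -⟩ := ih _ hl.2.2
      rw [Bool.not_not] at hfst
      have hg1 : (⟨g, hl.1⟩ : omitOne Γ m v w Set.univ b) ≠ 1 := by
        intro h
        apply hl.2.1
        rw [show g = 1 from congrArg Subtype.val h]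
        exact one_mem _
      refine ⟨CoprodI.Word.cons ⟨g, hl.1⟩ y hfst hg1, ?_, ?_, ?_, ?_⟩
      · intro z hz
        rcases List.mem_cons.mp hz with rfl | hz
        · rintro ⟨k, hk⟩
          apply hl.2.1
          rw [← show (k : A) = g from congrArg Subtype.val hk]
          exact k.2
        · exact hy z hz
      · rw [CoprodI.Word.prod_cons, map_mul, hprod, PushoutI.ofCoprodI_of, List.prod_cons, map_mul,
          ← hΦ]
      · rw [CoprodI.Word.fstIdx_cons]
        cases b <;> simp
      · intro _ h
        have := congrArg CoprodI.Word.toList h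
        simp [CoprodI.Word.cons, CoprodI.Word.empty] at this
  obtain ⟨x, hx, hprod, -, hxne⟩ := key l b hl
  intro hmem
  apply hxne hne
  apply hx.eq_empty_of_mem_range (fun b => Subgroup.inclusion_injective _)
  rw [hprod]
  refine ⟨⟨l.prod, hmem⟩, ?_⟩
  rw [← PushoutI.of_apply_eq_base _ true, ← hΦ]
  rfl

/-- With `IsAlternating.mono` this lets alternating words over `Y` be read over a larger vertex set:
their letters stay outside the larger amalgamated subgroup. -/
theorem omitOne_inf_omitBoth (hm : ∀ e, 2 ≤ m e) {Y Z : Set V} (b : Bool) :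
    omitOne Γ m v w Y b ⊓ omitBoth Γ m v w Z ≤ omitBoth Γ m v w Y := by
  rw [omitOne, omitBoth, standardParabolic_inf hm]
  exact standardParabolic_mono fun u hu => ⟨hu.1.1, hu.2.2⟩

theorem omitOne_mono {Y Z : Set V} (hYZ : Y ⊆ Z) (b : Bool) :
    omitOne Γ m v w Y b ≤ omitOne Γ m v w Z b :=
  standardParabolic_mono (Set.sdiff_subset_sdiff_left hYZ)

/-- Alternating products that start in different factors are different. -/
theorem IsAlternating.prod_ne_prod (hm : ∀ e, 2 ≤ m e) (hvw : v ≠ w) (hadj : ¬ Γ.Adj v w)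
    {Z : Set V} {b : Bool} {l l' : List A}
    (hl : IsAlternating (omitOne Γ m v w Z) (omitBoth Γ m v w Z) b l) (hne : l ≠ [])
    (hl' : IsAlternating (omitOne Γ m v w Z) (omitBoth Γ m v w Z) (!b) l') :
    l.prod ≠ l'.prod := by
  intro h
  obtain ⟨b', l'', h1, h2, h3⟩ := hl.exists_inv_mul hl'
  rw [h, inv_mul_cancel] at h2
  have hne' : l'' ≠ [] := by
    rintro rfl
    have := List.length_pos_of_ne_nil hne
    rw [List.length_nil] at h3
    omega
  refine (h1.mono (fun b => omitOne_mono (Set.subset_univ Z) b)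
    (fun b => omitOne_inf_omitBoth hm b)).prod_notMem hvw hadj hne' ?_
  rw [h2]
  exact one_mem _

open scoped Pointwise in
theorem mem_syllables_pow_of_mem (hvw : v ≠ w) {Z : Set V} {g : A}
    (hg : g ∈ standardParabolic Γ m Z) :
    ∃ n : ℕ, g ∈ syllables (omitOne Γ m v w Z) ^ n := by
  have hgen : ∀ x ∈ (PresentedGroup.of : V → A) '' Z, ∃ b, x ∈ omitOne Γ m v w Z b := by
    rintro _ ⟨u, hu, rfl⟩
    obtain ⟨b, hb⟩ := exists_mem_omit hvw u
    exact ⟨b, gen_mem ⟨hu, hb⟩⟩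
  induction hg using Subgroup.closure_induction_left with
  | one => exact ⟨0, by simp⟩
  | mul_left x hx g _ ih =>
    obtain ⟨n, hn⟩ := ih
    exact ⟨n + 1, by rw [pow_succ']; exact Set.mul_mem_mul (mem_syllables.mpr (hgen x hx)) hn⟩
  | inv_mul_cancel x hx g _ ih =>
    obtain ⟨n, hn⟩ := ih
    obtain ⟨b, hb⟩ := hgen x hx
    exact ⟨n + 1, by
      rw [pow_succ']; exact Set.mul_mem_mul (mem_syllables.mpr ⟨b, inv_mem hb⟩) hn⟩

end ArtinGroups

/-! ### The two inductions: on syllable length and on the vertex set. -/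

namespace ArtinGroups

variable {V : Type*} {Γ : SimpleGraph V} {m : Γ.edgeSet → ℕ}

local notation "A" => ArtinGroup Γ m

theorem IsParabolic.map_conj {P : Subgroup A} (hP : IsParabolic Γ m P) (g : A) :
    IsParabolic Γ m (P.map (MulAut.conj g).toMonoidHom) := by
  obtain ⟨X, a, rfl⟩ := hP
  exact ⟨X, g * a, conjParabolic_eq_map_mul g a⟩

theorem isParabolic_inf_mul_left {X Y : Set V} {a g : A} (s : A)
    (h : IsParabolic Γ m (conjParabolic Γ m a X ⊓ conjParabolic Γ m g Y)) :
    IsParabolic Γ m (conjParabolic Γ m (s * a) X ⊓ conjParabolic Γ m (s * g) Y) := by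
  have := h.map_conj s
  rwa [Subgroup.map_inf _ _ _ (MulAut.conj s).injective, conjParabolic_eq_map_mul,
    conjParabolic_eq_map_mul] at this

variable {v w : V} {Z : Set V}

open scoped Pointwise

/-- Multiplying a shortest coset representative by elements of `A_Y` keeps the first factor. -/
theorem exists_isAlternating_mul (hm : ∀ e, 2 ≤ m e) (hvw : v ≠ w) {Y : Set V} (hYZ : Y ⊆ Z)
    {b c : Bool} {n : ℕ} {l : List A} (hlen : l.length = n + 1)
    (hl : IsAlternating (omitOne Γ m v w Z) (omitBoth Γ m v w Z) c l)
    (hshort : ∀ y ∈ standardParabolic Γ m Y, ∀ k ≤ n,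
      l.prod * y ∉ syllables (omitOne Γ m v w Z) ^ k)
    (hhead : ∀ y ∈ standardParabolic Γ m Y, l.prod * y ∉ omitOne Γ m v w Z b)
    {y : A} (hy : y ∈ standardParabolic Γ m Y) :
    ∃ l', IsAlternating (omitOne Γ m v w Z) (omitBoth Γ m v w Z) c l' ∧ l' ≠ [] ∧
      l'.prod = l.prod * y := by
  have hK := omitBoth_le (Γ := Γ) (m := m) v w
  rcases List.eq_nil_or_concat' l with rfl | ⟨l₀, e, rfl⟩
  · simp at hlen
  obtain ⟨d, he, heK, happ⟩ := hl.append
  obtain ⟨k, hk⟩ := mem_syllables_pow_of_mem hvw hy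
  rcases exists_isAlternating_of_mem_pow (hK Y) hk with hyK | ⟨d', ys, hys, hne, -, rfl⟩
  · have hyK' : y ∈ omitBoth Γ m v w Z :=
      standardParabolic_mono (Set.sdiff_subset_sdiff_left hYZ) hyK
    refine ⟨l₀ ++ [e * y], happ _ ⟨mul_mem he (hK Z d hyK'), ?_, trivial⟩, by simp,
      by simp [mul_assoc]⟩
    rwa [Subgroup.mul_mem_cancel_right _ hyK']
  · have hys' := hys.mono (fun b => omitOne_mono (Γ := Γ) (m := m) hYZ b)
      (fun b => omitOne_inf_omitBoth (Z := Z) hm b)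
    by_cases hd : d' = d
    · subst hd
      obtain ⟨y₁, t, rfl⟩ := List.exists_cons_of_ne_nil hne
      by_cases h : e * y₁ ∈ omitBoth Γ m v w Z
      · exfalso
        have hy₁ : y₁ ∈ standardParabolic Γ m Y :=
          standardParabolic_mono Set.sdiff_subset hys.1
        have heq : (l₀ ++ [e]).prod * y₁ = l₀.prod * (e * y₁) := by simp [mul_assoc]
        rcases l₀.eq_nil_or_concat' with rfl | ⟨l₁, x, hx⟩
        · apply hhead y₁ hy₁
          rw [heq]
          simpa using hK Z b h
        · apply hshort y₁ hy₁ n le_rfl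
          rw [heq]
          have hlen' : l₀.length = l₁.length + 1 := by rw [hx]; simp
          have hn : n = l₁.length + 1 := by
            rw [List.length_append, List.length_singleton] at hlen
            omega
          rw [hn]
          refine mul_mem_syllables_pow (hK Z) ?_ h
          rw [← hlen']
          have hl₀ : IsAlternating (omitOne Γ m v w Z) (omitBoth Γ m v w Z) c l₀ := by
            have := happ [] trivial
            rwa [List.append_nil] at this
          exact hl₀.prod_mem
      · exact ⟨l₀ ++ (e * y₁) :: t, happ _ ⟨mul_mem he hys'.1, h, hys'.2.2⟩, by simp,
          by simp [mul_assoc]⟩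
    · have hd' : d' = !d := by
        revert hd
        cases d' <;> cases d <;> simp
      refine ⟨l₀ ++ e :: ys, happ _ ⟨he, heK, hd' ▸ hys'⟩, by simp, by simp [mul_assoc]⟩

/-- `hZ` is the outer induction hypothesis for the two factors. The factor `b` must vary in the
statement, because the last case passes to the other one. -/
theorem isParabolic_inf_of_syllables (hm : ∀ e, 2 ≤ m e) (hvw : v ≠ w) (hadj : ¬ Γ.Adj v w)
    (hZ : ∀ b, ∀ X ⊆ Z \ {pick v w b}, ∀ Y ⊆ Z \ {pick v w b}, FreeOfInfinity Γ X →
      ∀ a ∈ omitOne Γ m v w Z b, ∀ g ∈ omitOne Γ m v w Z b,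
        IsParabolic Γ m (conjParabolic Γ m a X ⊓ conjParabolic Γ m g Y))
    (n : ℕ) : ∀ b, ∀ X ⊆ Z \ {pick v w b}, ∀ Y ⊆ Z, FreeOfInfinity Γ X →
      ∀ a ∈ omitOne Γ m v w Z b, ∀ g ∈ syllables (omitOne Γ m v w Z) ^ n,
        IsParabolic Γ m (conjParabolic Γ m a X ⊓ conjParabolic Γ m g Y) := by
  induction n using Nat.strong_induction_on with
  | _ n ih =>
  intro b X hX Y hY hfree a ha g hg
  have hK := omitBoth_le (Γ := Γ) (m := m) v w Z
  have hle : conjParabolic Γ m a X ≤ omitOne Γ m v w Z b := conjParabolic_le hX ha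
  cases n with
  | zero =>
    rw [pow_zero, Set.mem_one] at hg
    subst hg
    have := hZ b X hX (Z \ {pick v w b} ∩ Y) Set.inter_subset_left hfree a ha 1 (one_mem _)
    rwa [conjParabolic_one, ← standardParabolic_inf hm, ← inf_assoc, inf_eq_left.mpr hle,
      ← conjParabolic_one (X := Y)] at this
  | succ n =>
    -- Conjugating by s⁻¹ keeps the complete parabolic subgroup inside the factor `c` and removes a
    -- syllable of the other conjugator.
    have peel : ∀ c, ∀ X ⊆ Z \ {pick v w c}, FreeOfInfinity Γ X → ∀ a ∈ omitOne Γ m v w Z c,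
        ∀ s ∈ omitOne Γ m v w Z c, ∀ g ∈ syllables (omitOne Γ m v w Z) ^ n,
        IsParabolic Γ m (conjParabolic Γ m a X ⊓ conjParabolic Γ m (s * g) Y) := by
      intro c X hX hfree a ha s hs g hg
      have := isParabolic_inf_mul_left s (ih n n.lt_succ_self c X hX Y hY hfree (s⁻¹ * a)
        (mul_mem (inv_mem hs) ha) g hg)
      rwa [mul_inv_cancel_left] at this
    by_cases hshort : ∃ y ∈ standardParabolic Γ m Y, ∃ k ≤ n,
        g * y ∈ syllables (omitOne Γ m v w Z) ^ k
    · obtain ⟨y, hy, k, hk, hgy⟩ := hshort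
      rw [← conjParabolic_mul_mem g hy]
      exact ih k (Nat.lt_succ_of_le hk) b X hX Y hY hfree a ha _ hgy
    by_cases hhead : ∃ y ∈ standardParabolic Γ m Y, ∃ s ∈ omitOne Γ m v w Z b,
        ∃ x ∈ syllables (omitOne Γ m v w Z) ^ n, g * y = s * x
    · obtain ⟨y, hy, s, hs, x, hx, hgy⟩ := hhead
      rw [← conjParabolic_mul_mem g hy, hgy]
      exact peel b X hX hfree a ha s hs x hx
    push Not at hshort hhead
    have hone : (1 : A) ∈ syllables (omitOne Γ m v w Z) ^ n :=
      Set.one_mem_pow (mem_syllables.mpr ⟨true, one_mem _⟩)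
    have hnotb : ∀ y ∈ standardParabolic Γ m Y, g * y ∉ omitOne Γ m v w Z b := fun y hy h =>
      hhead y hy _ h 1 hone (mul_one _).symm
    rcases exists_isAlternating_of_mem_pow hK hg with hgK | ⟨c, l, hl, hne, hlen, rfl⟩
    · exact absurd (by simpa using hK b hgK) (hnotb 1 (one_mem _))
    have hlen' : l.length = n + 1 := by
      by_contra h
      apply hshort 1 (one_mem _) l.length (by omega)
      rw [mul_one]
      exact hl.prod_mem
    obtain ⟨s, t, rfl⟩ := List.exists_cons_of_ne_nil hne
    have ht : t.prod ∈ syllables (omitOne Γ m v w Z) ^ n := by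
      have := hl.2.2.prod_mem
      rwa [show t.length = n by simpa using hlen'] at this
    have hcb : c = !b := by
      by_contra h
      have hcb : c = b := by
        revert h
        cases c <;> cases b <;> simp
      exact hhead 1 (one_mem _) s (hcb ▸ hl.1) t.prod ht (by simp)
    -- For h outside K the word h, s, t is alternating and starts in the factor `b`, while h g = g y
    -- with y ∈ A_Y also has an alternating word starting in the other factor.
    have hsub : conjParabolic Γ m a X ⊓ conjParabolic Γ m (s :: t).prod Y ≤
        omitBoth Γ m v w Z := by
      rintro h ⟨h1, h2⟩
      by_contra hhK
      replace h2 := mem_conjParabolic.mp h2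
      obtain ⟨l', hl', -, hprod⟩ :=
        exists_isAlternating_mul hm hvw hY hlen' hl hshort hnotb h2
      have halt : IsAlternating (omitOne Γ m v w Z) (omitBoth Γ m v w Z) b (h :: s :: t) :=
        ⟨hle h1, hhK, hcb ▸ hl⟩
      apply halt.prod_ne_prod hm hvw hadj (by simp) (hcb ▸ hl')
      rw [hprod, List.prod_cons]
      simp [mul_assoc]
    -- So P₁ can be replaced by P₁ ∩ K, which lies in both factors; viewed in the factor `c` of s,
    -- it allows s to be peeled off.
    obtain ⟨X', a', hX'⟩ := hZ b X hX (Z \ {v, w}) (by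
      apply Set.sdiff_subset_sdiff_right
      cases b <;> simp [pick]) hfree a ha 1 (one_mem _)
    rw [conjParabolic_one] at hX'
    have hfree' : FreeOfInfinity Γ X' :=
      hfree.of_conjParabolic_le hm (hX'.symm.le.trans inf_le_left)
    obtain ⟨X'', hX''Z, a'', ha'', heq, hiff⟩ := exists_eq_conjParabolic_of_le hm
      ((hX'.symm.le.trans inf_le_right).trans (hK c))
    have := peel c X'' hX''Z (hiff.mp hfree') a'' ha'' s hl.1 t.prod ht
    rwa [← heq, ← hX', inf_assoc, inf_comm (standardParabolic Γ m (Z \ {v, w})), ← inf_assoc,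
      ← List.prod_cons, inf_eq_left.mpr hsub] at this

theorem isParabolic_inf_of_propertyInt [Finite V] (hm : ∀ e, 2 ≤ m e) (hInt : PropertyInt Γ m)
    (n : ℕ) : ∀ Z : Set V, Z.ncard = n → ∀ X ⊆ Z, ∀ Y ⊆ Z, FreeOfInfinity Γ X →
      ∀ a ∈ standardParabolic Γ m Z, ∀ g ∈ standardParabolic Γ m Z,
        IsParabolic Γ m (conjParabolic Γ m a X ⊓ conjParabolic Γ m g Y) := by
  induction n using Nat.strong_induction_on with
  | _ n ih =>
  intro Z hZn X hX Y hY hfree a ha g hg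
  by_cases hZ : FreeOfInfinity Γ Z
  · exact hInt Z hZ _ _ ⟨X, hX, a, ha, rfl⟩ ⟨Y, hY, g, hg, rfl⟩
  · rw [FreeOfInfinity] at hZ
    push Not at hZ
    obtain ⟨v, hv, w, hw, hvw, hadj⟩ := hZ
    -- A set free of infinity cannot contain both of the nonadjacent vertices.
    have hb : ∃ b, X ⊆ Z \ {pick v w b} := by
      by_contra! h
      have hmem : ∀ b, pick v w b ∈ X := by
        intro b
        by_contra hb
        exact h b fun x hx => ⟨hX hx, fun hx' => hb ((Set.mem_singleton_iff.mp hx') ▸ hx)⟩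
      exact hadj (hfree v (hmem true) w (hmem false) hvw)
    obtain ⟨b, hXb⟩ := hb
    obtain ⟨k, hk⟩ := mem_syllables_pow_of_mem hvw (mul_mem (inv_mem ha) hg)
    have := isParabolic_inf_mul_left a (isParabolic_inf_of_syllables hm hvw hadj (fun c => by
      refine ih _ ?_ (Z \ {pick v w c}) rfl
      rw [← hZn]
      apply Set.ncard_sdiff_singleton_lt_of_mem _ (Set.toFinite Z)
      cases c
      · exact hw
      · exact hv) k b X hXb Y hY hfree 1 (one_mem _) _ hk)
    rwa [mul_one, mul_inv_cancel_left] at this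

end ArtinGroups

theorem mainTheorem1 {V : Type*} [Finite V] (Γ : SimpleGraph V) (m : Γ.edgeSet → ℕ)
    (hm : ∀ e, 2 ≤ m e) (hInt : ArtinGroups.PropertyInt Γ m) :
    ArtinGroups.PropertyIntPlusMinus Γ m := by
  rintro _ _ ⟨X, a, hX, rfl⟩ ⟨Y, g, rfl⟩
  exact ArtinGroups.isParabolic_inf_of_propertyInt hm hInt _ Set.univ rfl X (Set.subset_univ X) Y
    (Set.subset_univ Y) hX a (by rw [ArtinGroups.standardParabolic_univ]; trivial) g
    (by rw [ArtinGroups.standardParabolic_univ]; trivial)
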